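/- **Setting.** Let $H$ be a nonzero homogeneous polynomial of degree $4$ on $V=\mathbb R^2$, let $\Omega$ be an invertible antisymmetric real $2\times2$ matrix, $\omega(u,v)=u^T\Omega v$, $K=\Omega^{-1}$, and let $h\neq0$ be real. Let $F(x_0,x_1,x_2)=\frac16\,\partial_{\lambda_0}\partial_{\lambda_1}\partial_{\lambda_2}f(\lambda_0x_0+\lambda_1x_1+\lambda_2x_2)|_{\lambda=0}$ be the polarization of the cubic Hamiltonian vector field $f=K\nabla H$. The polar map is $\varphi(x_0,x_1)=(x_1,x_2)$ on $V^2=\mathbb R^4$, where $x_2$ solves the linear system $$\frac{x_2-x_0}{2h}=F(x_0,x_1,x_2).$$ Put $D(x_0,x_1)=\det\bigl(I-2h\,F(x_0,x_1,\cdot)\bigr)$ and $\psi=\varphi\circ\varphi$. "Generically" means: off the zero set of some nonzero polynomial. **Theorem.** Generically $D\ne0$; where $D\neq 0$ the linear system has a unique solution $x_2$; and for almost every initial point all iterates of $\varphi$ are given by this system. The polar map is completely integrable through its second iterate $\psi$, in the following sense. 1. $\varphi$ is birational and preserves the measure $\mu=|D|^{-1}dx_0\,dx_1$. 2. The scaling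 group $T_c(x_0,x_1)=(cx_0,c^{-1}x_1)$, $c\in\mathbb R^\times$, preserves $\mu$ and commutes with $\psi$. 3. $I_1=\omega(x_0,x_1)$ and $I_2=\omega(x_1,x_2)$ are rational integrals of $\psi$, are functionally independent (their differentials are generically linearly independent), and are invariant under the scaling group. 4. There are a rational map $\pi:\mathbb R^4\to\mathbb R^3$ and a rational function $s$, generically nonzero, with $\pi\circ T_c=\pi$ and $s\circ T_c=c\,s$, such that $(\pi,s)$ restricts to a bijection from $\{s\ne0\}$ onto $\mathbb R^3\times\mathbb R^\times$ with rational inverse $R$. On $\{s\neq0\}$ the fibres of $\pi$ are exactly the orbits of the scaling group. There is a measure $\nu=|\rho(y)|\,dy$ on $\mathbb R^3$, with $\rho$ rational and generically nonzero, such that $(\pi,s)_*\mu=\nu\otimes dt/|t|$. 5. $\psi$ descends to a birational map $\Psi$ of $\mathbb R^3$, that is, $\pi\circ\psi=\Psi\circ\pi$ generically. The map $\Psi$ preserves $\nu$ and has two functionally independent rational integrals $J_1,J_2$ with $J_i\circ\pi=I_i$ generically. It is integrable: there is a rational, generically nonzero vector field $X$ on $\mathbb R^3$, tangent to the level curves of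 $(J_1,J_2)$, with $D\Psi(y)X(y)=X(\Psi(y))$ generically, so that in the time of the flow of $X$ the map $\Psi$ acts on level curves as a translation. 6. (Reconstruction.) There is a rational function $g$ on $\mathbb R^3$, generically nonzero, with $s\circ\psi=(g\circ\pi)\,s$ generically. For almost every $x\in\mathbb R^4$ and all $m\ge0$, with $y_m=\Psi^m(\pi(x))$ and $s_m=s(\psi^m(x))$, we have $\pi(\psi^m(x))=y_m$, $s_m\ne0$ and $g(y_m)\ne0$, and $u_m=\log|s_m|$ obeys the scalar linear constant-coefficient nonautonomous difference equation $$u_{m+1}=u_m+\log|g(y_m)|.$$ Moreover $\varphi^{2m+j}(x)=\varphi^{j}\Bigl(R\bigl(y_m,\ s(x)\prod_{i<m}g(y_i)\bigr)\Bigr)$ for $j=0,1$. -/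

import Mathlib

open MeasureTheory

/-! ### Rational functions and rational maps on real vector spaces

Rational maps are represented by total functions; their values on a proper algebraic subset
are irrelevant. -/

section Rational

variable {E F : Type*} [AddCommGroup E] [Module ℝ E] [AddCommGroup F] [Module ℝ F]

/-- Polynomial functions: the algebra of functions generated by the linear functionals. -/
def IsPolynomialFun (p : E → ℝ) : Prop :=
  p ∈ Algebra.adjoin ℝ {q : E → ℝ | ∃ l : E →ₗ[ℝ] ℝ, q = fun x => l x}

/-- `P` holds off the zero set of some polynomial function that is not identically zero. -/
def Generically (P : E → Prop) : Prop :=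
  ∃ p : E → ℝ, IsPolynomialFun p ∧ p ≠ 0 ∧ ∀ x, p x ≠ 0 → P x

/-- `f` agrees with a quotient of two polynomial functions wherever the denominator, which is not
identically zero, does not vanish. -/
def IsRationalFun (f : E → ℝ) : Prop :=
  ∃ p q : E → ℝ, IsPolynomialFun p ∧ IsPolynomialFun q ∧ q ≠ 0 ∧
    ∀ x, q x ≠ 0 → f x = p x / q x

/-- A map is rational if each of its coordinates (in any linear coordinate system) is. -/
def IsRationalMap (f : E → F) : Prop :=
  ∀ l : F →ₗ[ℝ] ℝ, IsRationalFun fun x => l (f x)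

/-- A rational map with a rational inverse. -/
def IsBirational (f : E → F) : Prop :=
  IsRationalMap f ∧ ∃ g : F → E, IsRationalMap g ∧
    (Generically fun x => g (f x) = x) ∧ (Generically fun y => f (g y) = y)

end Rational

/-- The measure `|ρ(x)| dx`. -/
noncomputable def densityMeasure {E : Type*} [MeasureSpace E] (ρ : E → ℝ) : Measure E :=
  volume.withDensity fun x => ENNReal.ofReal |ρ x|

/-! ### Integrability -/

/-- Functional independence: the differentials are linearly independent at a generic point. -/
def FunctionallyIndependent {E : Type*} [NormedAddCommGroup E] [NormedSpace ℝ E] {r : ℕ}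
    (I : Fin r → E → ℝ) : Prop :=
  Generically fun x => LinearIndependent ℝ fun i => fderiv ℝ (I i) x

/-- Integrability of a birational measure-preserving map `Ψ` of an `(r+1)`-dimensional space with
`r` functionally independent rational integrals. The last field is the dynamical content: there is
a rational vector field `X`, generically nonzero and tangent to the common level curves of the
integrals, which `Ψ` carries into itself; so, when level curves are parametrized by the time of the
flow of `X`, the map acts on them as a translation. -/
structure IsIntegrableMap {E : Type*} [NormedAddCommGroup E] [NormedSpace ℝ E] [MeasureSpace E]
    {r : ℕ} (Ψ : E → E) (ρ : E → ℝ) (J : Fin r → E → ℝ) : Prop where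
  finrank_eq : Module.finrank ℝ E = r + 1
  birational : IsBirational Ψ
  density_rational : IsRationalFun ρ
  density_ne_zero : Generically fun y => ρ y ≠ 0
  measurePreserving : MeasurePreserving Ψ (densityMeasure ρ) (densityMeasure ρ)
  integral_rational : ∀ i, IsRationalFun (J i)
  integral_invariant : ∀ i, Generically fun y => J i (Ψ y) = J i y
  integral_independent : FunctionallyIndependent J
  translation : ∃ X : E → E, IsRationalMap X ∧ Generically fun y =>
    X y ≠ 0 ∧ (∀ i, fderiv ℝ (J i) y (X y) = 0) ∧
      DifferentiableAt ℝ Ψ y ∧ fderiv ℝ Ψ y (X y) = X (Ψ y)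

/-- The map `ψ` has the one-dimensional measure-preserving symmetry group `T` (a rational action of
the multiplicative group `ℝˣ`), with respect to the measure with density `ρ`. -/
structure IsMeasurePreservingSymmetry {E : Type*} [NormedAddCommGroup E] [NormedSpace ℝ E]
    [MeasureSpace E] (ψ : E → E) (T : ℝˣ → E → E) (ρ : E → ℝ) : Prop where
  action_one : ∀ x, T 1 x = x
  action_mul : ∀ a b x, T (a * b) x = T a (T b x)
  rational : ∀ c, IsRationalMap (T c)
  measurePreserving : ∀ c, MeasurePreserving (T c) (densityMeasure ρ) (densityMeasure ρ)
  equivariant : ∀ c x, ψ (T c x) = T c (ψ x)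

/-- `π : E → Q` is the quotient by the action `T`, and `s` is a coordinate along the orbits:
`(π, s)` is a birational identification, with inverse `R`, of `E` with `Q × ℝ`, which restricts to
a bijection from `{s ≠ 0}` to `Q × (ℝ ∖ {0})` under which `T c` becomes `(y, t) ↦ (y, c t)`.
The measure `|ρ'(y)| dy` on `Q` is the quotient of the measure `|ρ(x)| dx` by the Haar measure
`dt/|t|` of the group. -/
structure IsQuotientBy {E Q : Type*} [NormedAddCommGroup E] [NormedSpace ℝ E] [MeasureSpace E]
    [NormedAddCommGroup Q] [NormedSpace ℝ Q] [MeasureSpace Q]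
    (T : ℝˣ → E → E) (ρ : E → ℝ) (π : E → Q) (s : E → ℝ) (R : Q × ℝ → E) (ρ' : Q → ℝ) :
    Prop where
  finrank_eq : Module.finrank ℝ E = Module.finrank ℝ Q + 1
  proj_rational : IsRationalMap π
  fibre_rational : IsRationalFun s
  inverse_rational : IsRationalMap R
  fibre_ne_zero : Generically fun x => s x ≠ 0
  left_inv : ∀ x, s x ≠ 0 → R (π x, s x) = x
  right_inv : ∀ y t, t ≠ 0 → π (R (y, t)) = y ∧ s (R (y, t)) = t
  proj_invariant : ∀ c x, π (T c x) = π x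
  fibre_equivariant : ∀ (c : ℝˣ) x, s (T c x) = c * s x
  orbits : ∀ x x', s x ≠ 0 → s x' ≠ 0 → (π x = π x' ↔ ∃ c : ℝˣ, T c x = x')
  measure_eq : Measure.map (fun x => (π x, s x)) (densityMeasure ρ) =
    (densityMeasure ρ').prod (densityMeasure fun t : ℝ => 1 / t)

/-- Complete integrability of a birational map `φ` of an `(r+2)`-dimensional space through
reduction of its `p`-th iterate. The map `φ` preserves the measure with density `ρ`; the iterate
`φ^[p]` has `r` independent integrals `I` and the one-dimensional measure-preserving symmetry group
`T`; it descends to an integrable map `Ψ` of the `(r+1)`-dimensional quotient, with the integrals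
`J` induced by `I`; and the logarithm of the orbit coordinate obeys a scalar linear
constant-coefficient nonautonomous difference equation along orbits of `Ψ`, through which the
orbits of `φ` are recovered from those of `Ψ`. -/
def IsCompletelyIntegrable {E : Type*} [NormedAddCommGroup E] [NormedSpace ℝ E] [MeasureSpace E]
    {r : ℕ} (φ : E → E) (p : ℕ) (T : ℝˣ → E → E) (ρ : E → ℝ) (I : Fin r → E → ℝ) : Prop :=
  0 < p ∧ Module.finrank ℝ E = r + 2 ∧ IsBirational φ ∧
  -- the invariant measure
  IsRationalFun ρ ∧ (Generically fun x => ρ x ≠ 0) ∧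
  MeasurePreserving φ (densityMeasure ρ) (densityMeasure ρ) ∧
  -- the symmetry group of the iterate
  IsMeasurePreservingSymmetry φ^[p] T ρ ∧
  -- the integrals of the iterate
  (∀ i, IsRationalFun (I i)) ∧ (∀ i, Generically fun x => I i (φ^[p] x) = I i x) ∧
  FunctionallyIndependent I ∧ (∀ i c x, I i (T c x) = I i x) ∧
  -- the quotient
  ∃ (π : E → Fin (r + 1) → ℝ) (s : E → ℝ) (R : (Fin (r + 1) → ℝ) × ℝ → E)
    (Ψ : (Fin (r + 1) → ℝ) → Fin (r + 1) → ℝ) (ρ' : (Fin (r + 1) → ℝ) → ℝ)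
    (J : Fin r → (Fin (r + 1) → ℝ) → ℝ) (g : (Fin (r + 1) → ℝ) → ℝ),
    IsQuotientBy T ρ π s R ρ' ∧
    (Generically fun x => π (φ^[p] x) = Ψ (π x)) ∧
    (∀ i, Generically fun x => J i (π x) = I i x) ∧
    IsIntegrableMap Ψ ρ' J ∧
    -- the reconstruction
    IsRationalFun g ∧ (Generically fun y => g y ≠ 0) ∧
    (Generically fun x => s (φ^[p] x) = g (π x) * s x) ∧
    ∀ᵐ x, ∀ n : ℕ,
      s (φ^[p * n] x) ≠ 0 ∧ g (Ψ^[n] (π x)) ≠ 0 ∧ π (φ^[p * n] x) = Ψ^[n] (π x) ∧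
      Real.log |s (φ^[p * (n + 1)] x)| =
        Real.log |s (φ^[p * n] x)| + Real.log |g (Ψ^[n] (π x))| ∧
      ∀ j < p, φ^[p * n + j] x =
        φ^[j] (R (Ψ^[n] (π x), (∏ i ∈ Finset.range n, g (Ψ^[i] (π x))) * s x))

/-! ### Polarization and the polar map -/

section Polar

variable {n : ℕ}

/-- The derivative of a polynomial in the direction of the constant vector `v`. -/
noncomputable def dirDeriv (v : Fin n → ℝ) (p : MvPolynomial (Fin n) ℝ) :
    MvPolynomial (Fin n) ℝ :=
  ∑ j, MvPolynomial.C (v j) * MvPolynomial.pderiv j p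

/-- The polarization `(1/d!) ∂/∂λ₁ ⋯ ∂/∂λ_d p(λ₁ x₁ + ⋯ + λ_d x_d)` at `λ = 0` of a homogeneous
polynomial `p` of degree `d`. By the chain rule it is `1/d!` times the value at the origin of the
iterated directional derivative of `p` along `x₁, …, x_d`. -/
noncomputable def polarization {d : ℕ} (p : MvPolynomial (Fin n) ℝ) (x : Fin d → Fin n → ℝ) : ℝ :=
  1 / (d.factorial : ℝ) * MvPolynomial.eval 0 ((List.ofFn x).foldr dirDeriv p)

/-- The polarization `F` of a homogeneous polynomial vector field. -/
noncomputable def polarField {d : ℕ} (f : Fin n → MvPolynomial (Fin n) ℝ)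
    (x : Fin d → Fin n → ℝ) : Fin n → ℝ :=
  fun i => polarization (f i) x

/-- With `k = m + 1`: the polar map sends `x = (x₀, …, x_{k-1})` to `y = (x₁, …, x_k)`, where
`(x_k - x₀) / (k h) = F(x₀, …, x_k)`. -/
def IsPolarStep {m : ℕ} (f : Fin n → MvPolynomial (Fin n) ℝ) (h : ℝ)
    (x y : Fin (m + 1) → Fin n → ℝ) : Prop :=
  (∀ i : Fin m, y i.castSucc = x i.succ) ∧
  (1 / (((m : ℝ) + 1) * h)) • (y (Fin.last m) - x 0) =
    polarField f (Fin.snoc x (y (Fin.last m)) : Fin (m + 2) → Fin n → ℝ)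

/-- The matrix of the linear map `v ↦ F(x₀, …, x_{k-1}, v)`. -/
noncomputable def polarMatrix {m : ℕ} (f : Fin n → MvPolynomial (Fin n) ℝ)
    (x : Fin (m + 1) → Fin n → ℝ) : Matrix (Fin n) (Fin n) ℝ :=
  Matrix.of fun i j => polarField f (Fin.snoc x (Pi.single j 1) : Fin (m + 2) → Fin n → ℝ) i

/-- The matrix `I - k h F(x₀, …, x_{k-1}, ·)` of the linear system that determines `x_k`. -/
noncomputable def polarSystem {m : ℕ} (f : Fin n → MvPolynomial (Fin n) ℝ) (h : ℝ)
    (x : Fin (m + 1) → Fin n → ℝ) : Matrix (Fin n) (Fin n) ℝ :=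
  1 - (((m : ℝ) + 1) * h) • polarMatrix f x

/-- The polar map associated with the homogeneous vector field `f` of degree `k + 1 = m + 2` and
the time step `h`: it solves the linear system for `x_k`, where that system is regular. -/
noncomputable def polarMap {m : ℕ} (f : Fin n → MvPolynomial (Fin n) ℝ) (h : ℝ)
    (x : Fin (m + 1) → Fin n → ℝ) : Fin (m + 1) → Fin n → ℝ :=
  Fin.snoc (Fin.tail x) ((polarSystem f h x)⁻¹.mulVec (x 0))

/-- The Hamiltonian vector field `K ∇H`, where `K = Ω⁻¹`. -/
noncomputable def hamiltonianField (Ω : Matrix (Fin n) (Fin n) ℝ) (H : MvPolynomial (Fin n) ℝ) :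
    Fin n → MvPolynomial (Fin n) ℝ :=
  fun i => ∑ j, MvPolynomial.C (Ω⁻¹ i j) * MvPolynomial.pderiv j H

/-- The symplectic form `ω(u, v) = uᵀ Ω v`. -/
def symplecticForm (Ω : Matrix (Fin n) (Fin n) ℝ) (u v : Fin n → ℝ) : ℝ :=
  u ⬝ᵥ Ω.mulVec v

/-- The scaling group `(x₀, x₁) ↦ (c x₀, c⁻¹ x₁)` on pairs of vectors. -/
def scaling (c : ℝˣ) (x : Fin 2 → Fin n → ℝ) : Fin 2 → Fin n → ℝ :=
  ![(c : ℝ) • x 0, ((c⁻¹ : ℝˣ) : ℝ) • x 1]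

end Polar

/-! ### Polynomial functions, rational functions and genericity -/

section Algebra

variable {E F : Type*} [AddCommGroup E] [Module ℝ E] [AddCommGroup F] [Module ℝ F]

namespace IsPolynomialFun

/-! Write A(x₀, x₁) = 2h F(x₀, x₁, ·), so that the system reads (I - A(x₀, x₁)) x₂ = x₀. Since f =
K∇H, the form ω(F(x₀, x₁, x₂), x₃) is, up to a constant factor, the quartic H polarized. Hence F is
symmetric in all its arguments and A is infinitesimally symplectic, which in the plane means
traceless. So (I - A)(I + A) = D·I with D = 1 + det A, and D is symmetric in x₀, x₁ and even in h.

By symmetry the same system says x₂ = (I + A(x₁, x₂)) x₀. This has three consequences. Reversing the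
sign of h inverts the map, which is therefore birational. Differentiation at fixed x₁ gives (I -
A(x₀, x₁)) dx₂ = (I + A(x₁, x₂)) dx₀, so x₀ ↦ x₂ has Jacobian determinant D(x₁, x₂) / D(x₀, x₁), and
dx₀ dx₁ / |D| is invariant. Finally, with A = A(x₁, x₂), ω(x₂, x₃) = ω((I + A) x₀, x₃) = ω(x₀, (I -
A) x₃) = ω(x₀, x₁): φ exchanges the two areas I₁ and I₂, and ψ preserves both (`polar_area`).

The scaling leaves A unchanged, so φ T_c = T_{1/c} φ. Thus φ itself descends to a map Φ of the
quotient, and Ψ = Φ². In the coordinates y = π(x), t = s(x), φ is (y, t) ↦ (Φ(y), y₁/t). Since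
dt/|t| is invariant under t ↦ c/t, Φ preserves ν (`measurePreserving_reducedStep`).

The map Φ exchanges J₁ and J₂ and changes the sign of the volume form dy/D
(`exists_hasFDerivAt_reducedStep`). The two signs cancel in X = D ∇J₁ × ∇J₂, so Φ, and with it Ψ,
preserves X. This field is not identically zero: along the shear x₀ ↦ x₀ + εx₁, which fixes J₁, the
derivative of J₂ has as its term of lowest order in x₁ a multiple of the quartic polarized at (x₀,
x₁, x₁, x₁), and H ≠ 0 (`exists_transversality_ne_zero`).

Composition of rational maps needs dominance. Here this is always supplied by measure theory: a map
that pulls null sets back to null sets cannot land in a proper algebraic subset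
(`Generically.comp`). -/

theorem const (c : ℝ) : IsPolynomialFun fun _ : E => c :=
  Subalgebra.algebraMap_mem _ c

theorem linear (l : E →ₗ[ℝ] ℝ) : IsPolynomialFun fun x => l x :=
  Algebra.subset_adjoin ⟨l, rfl⟩

theorem add {p q : E → ℝ} (hp : IsPolynomialFun p) (hq : IsPolynomialFun q) :
    IsPolynomialFun fun x => p x + q x :=
  Subalgebra.add_mem _ hp hq

theorem sub {p q : E → ℝ} (hp : IsPolynomialFun p) (hq : IsPolynomialFun q) :
    IsPolynomialFun fun x => p x - q x :=
  Subalgebra.sub_mem _ hp hq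

theorem mul {p q : E → ℝ} (hp : IsPolynomialFun p) (hq : IsPolynomialFun q) :
    IsPolynomialFun fun x => p x * q x :=
  Subalgebra.mul_mem _ hp hq

theorem pow {p : E → ℝ} (hp : IsPolynomialFun p) (k : ℕ) : IsPolynomialFun fun x => p x ^ k :=
  Subalgebra.pow_mem _ hp k

theorem fst_coord {ι : Type*} (i : ι) : IsPolynomialFun fun x : (ι → ℝ) × ℝ => x.1 i :=
  linear (LinearMap.proj i ∘ₗ LinearMap.fst ℝ (ι → ℝ) ℝ)

theorem snd {G : Type*} [AddCommGroup G] [Module ℝ G] :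
    IsPolynomialFun fun x : G × ℝ => x.2 :=
  linear (LinearMap.snd ℝ G ℝ)

theorem coord {ι : Type*} (i : ι) : IsPolynomialFun fun x : ι → ℝ => x i :=
  linear (LinearMap.proj i : (ι → ℝ) →ₗ[ℝ] ℝ)

theorem coord₂ {ι κ : Type*} (i : ι) (j : κ) : IsPolynomialFun fun x : ι → κ → ℝ => x i j :=
  linear (LinearMap.proj j ∘ₗ (LinearMap.proj i : (ι → κ → ℝ) →ₗ[ℝ] κ → ℝ))

/-- The restriction of a polynomial function to a line. -/
theorem exists_polynomial_line {p : E → ℝ} (hp : IsPolynomialFun p) (x v : E) :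
    ∃ P : Polynomial ℝ, ∀ t : ℝ, p (x + t • v) = P.eval t := by
  refine Algebra.adjoin_induction (p := fun p _ => ∃ P : Polynomial ℝ,
    ∀ t : ℝ, p (x + t • v) = P.eval t) ?_ ?_ ?_ ?_ hp
  · rintro _ ⟨l, rfl⟩
    exact ⟨.C (l x) + .C (l v) * .X, fun t => by
      change l (x + t • v) = _
      rw [map_add, map_smul, smul_eq_mul, Polynomial.eval_add, Polynomial.eval_mul_X,
        Polynomial.eval_C, Polynomial.eval_C, mul_comm t]⟩
  · exact fun r => ⟨.C r, fun t => by simp⟩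
  · rintro p q - - ⟨P, hP⟩ ⟨Q, hQ⟩
    exact ⟨P + Q, fun t => by simp [hP, hQ]⟩
  · rintro p q - - ⟨P, hP⟩ ⟨Q, hQ⟩
    exact ⟨P * Q, fun t => by simp [hP, hQ]⟩

/-- A polynomial function not vanishing at `x` has finitely many zeros on each line through `x`. -/
theorem finite_zeros_line {p : E → ℝ} (hp : IsPolynomialFun p) {x : E} (hx : p x ≠ 0) (v : E) :
    {t : ℝ | p (x + t • v) = 0}.Finite := by
  obtain ⟨P, hP⟩ := hp.exists_polynomial_line x v
  have hP0 : P ≠ 0 := by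
    rintro rfl
    exact hx (by simpa using hP 0)
  refine (P.roots.toFinset.finite_toSet).subset fun t ht => ?_
  simpa [hP0, ← hP] using ht

/-- On the line joining a point where p ≠ 0 to a point where q ≠ 0, each factor has only finitely
many zeros, so some point of the line avoids both zero sets. This makes generic properties stable
under conjunction. -/
theorem mul_ne_zero {p q : E → ℝ} (hp : IsPolynomialFun p) (hq : IsPolynomialFun q)
    (hp0 : p ≠ 0) (hq0 : q ≠ 0) : (fun x => p x * q x) ≠ 0 := by
  obtain ⟨x, hx⟩ := Function.ne_iff.1 hp0
  obtain ⟨y, hy⟩ := Function.ne_iff.1 hq0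
  have h1 := hp.finite_zeros_line hx (y - x)
  have h2 : {t : ℝ | q (x + t • (y - x)) = 0}.Finite := by
    refine ((hq.finite_zeros_line hy (y - x)).image fun t => t + 1).subset fun t ht => ?_
    refine ⟨t - 1, ?_, by simp⟩
    rw [Set.mem_ofPred_eq] at ht ⊢
    rw [← ht]
    congr 1
    module
  obtain ⟨t, ht⟩ := (h1.union h2).exists_notMem
  refine Function.ne_iff.2 ⟨x + t • (y - x), ?_⟩
  simpa [not_or] using ht

end IsPolynomialFun

namespace Generically

theorem mono {P Q : E → Prop} (hP : Generically P) (h : ∀ x, P x → Q x) : Generically Q := by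
  obtain ⟨p, hp, hp0, H⟩ := hP
  exact ⟨p, hp, hp0, fun x hx => h x (H x hx)⟩

theorem and {P Q : E → Prop} (hP : Generically P) (hQ : Generically Q) :
    Generically fun x => P x ∧ Q x := by
  obtain ⟨p, hp, hp0, H⟩ := hP
  obtain ⟨q, hq, hq0, H'⟩ := hQ
  exact ⟨_, hp.mul hq, hp.mul_ne_zero hq hp0 hq0, fun x hx =>
    ⟨H x (left_ne_zero_of_mul hx), H' x (right_ne_zero_of_mul hx)⟩⟩

theorem polynomial_ne_zero {p : E → ℝ} (hp : IsPolynomialFun p) {x : E} (hx : p x ≠ 0) :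
    Generically fun x => p x ≠ 0 :=
  ⟨p, hp, Function.ne_iff.2 ⟨x, hx⟩, fun _ => id⟩

end Generically

namespace IsRationalFun

theorem of_polynomial {p : E → ℝ} (hp : IsPolynomialFun p) : IsRationalFun p :=
  ⟨p, fun _ => 1, hp, .const 1, Function.ne_iff.2 ⟨0, one_ne_zero⟩, fun x _ => by simp⟩

theorem const (c : ℝ) : IsRationalFun fun _ : E => c := of_polynomial (.const c)

theorem congr {f g : E → ℝ} (hf : IsRationalFun f) (h : Generically fun x => g x = f x) :
    IsRationalFun g := by
  obtain ⟨p, q, hp, hq, hq0, H⟩ := hf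
  obtain ⟨r, hr, hr0, H'⟩ := h
  refine ⟨_, _, hp.mul hr, hq.mul hr, hq.mul_ne_zero hr hq0 hr0, fun x hx => ?_⟩
  have h1 := left_ne_zero_of_mul hx
  have h2 := right_ne_zero_of_mul hx
  rw [H' x h2, H x h1, mul_div_mul_right _ _ h2]

theorem add {f g : E → ℝ} (hf : IsRationalFun f) (hg : IsRationalFun g) :
    IsRationalFun fun x => f x + g x := by
  obtain ⟨p, q, hp, hq, hq0, H⟩ := hf
  obtain ⟨r, s, hr, hs, hs0, H'⟩ := hg
  refine ⟨_, _, (hp.mul hs).add (hq.mul hr), hq.mul hs, hq.mul_ne_zero hs hq0 hs0, fun x hx => ?_⟩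
  have h1 := left_ne_zero_of_mul hx
  have h2 := right_ne_zero_of_mul hx
  simp only [H x h1, H' x h2, div_add_div _ _ h1 h2]

theorem mul {f g : E → ℝ} (hf : IsRationalFun f) (hg : IsRationalFun g) :
    IsRationalFun fun x => f x * g x := by
  obtain ⟨p, q, hp, hq, hq0, H⟩ := hf
  obtain ⟨r, s, hr, hs, hs0, H'⟩ := hg
  refine ⟨_, _, hp.mul hr, hq.mul hs, hq.mul_ne_zero hs hq0 hs0, fun x hx => ?_⟩
  simp only [H x (left_ne_zero_of_mul hx), H' x (right_ne_zero_of_mul hx), div_mul_div_comm]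

theorem inv {f : E → ℝ} (hf : IsRationalFun f) : IsRationalFun fun x => (f x)⁻¹ := by
  obtain ⟨p, q, hp, hq, hq0, H⟩ := hf
  by_cases hp0 : p = 0
  · exact ⟨fun _ => 0, q, .const 0, hq, hq0, fun x hx => by simp [H x hx, hp0]⟩
  · refine ⟨_, _, hq.mul hq, hp.mul hq, hp.mul_ne_zero hq hp0 hq0, fun x hx => ?_⟩
    simp only [H x (right_ne_zero_of_mul hx), inv_div, mul_div_mul_right _ _ (right_ne_zero_of_mul hx)]

theorem neg {f : E → ℝ} (hf : IsRationalFun f) : IsRationalFun fun x => -f x := by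
  simpa using (const (-1)).mul hf

theorem sub {f g : E → ℝ} (hf : IsRationalFun f) (hg : IsRationalFun g) :
    IsRationalFun fun x => f x - g x := by
  simpa only [sub_eq_add_neg] using hf.add hg.neg

theorem div {f g : E → ℝ} (hf : IsRationalFun f) (hg : IsRationalFun g) :
    IsRationalFun fun x => f x / g x := by
  simpa only [div_eq_mul_inv] using hf.mul hg.inv

theorem sum {ι : Type*} (s : Finset ι) {f : ι → E → ℝ} (hf : ∀ i, IsRationalFun (f i)) :
    IsRationalFun fun x => ∑ i ∈ s, f i x := by
  classical
  induction s using Finset.induction_on with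
  | empty => simpa using const 0
  | insert a s ha ih => simpa only [Finset.sum_insert ha] using (hf a).add ih

theorem comp_polynomial {f : E → F} (hf : IsRationalMap f) {p : F → ℝ} (hp : IsPolynomialFun p) :
    IsRationalFun fun x => p (f x) := by
  refine Algebra.adjoin_induction (p := fun p _ => IsRationalFun fun x => p (f x))
    ?_ ?_ ?_ ?_ hp
  · rintro _ ⟨l, rfl⟩
    exact hf l
  · exact fun r => const r
  · exact fun p q _ _ h1 h2 => h1.add h2
  · exact fun p q _ _ h1 h2 => h1.mul h2

/-- A rational function that is nonzero generically off a proper subset is generically nonzero. -/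
theorem exists_num_ne_zero {f : E → ℝ} (hf : IsRationalFun f) :
    (Generically fun x => f x ≠ 0) ∨ Generically fun x => f x = 0 := by
  obtain ⟨p, q, hp, hq, hq0, H⟩ := hf
  by_cases hp0 : p = 0
  · exact .inr ⟨q, hq, hq0, fun x hx => by simp [H x hx, hp0]⟩
  · refine .inl ⟨_, hp.mul hq, hp.mul_ne_zero hq hp0 hq0, fun x hx => ?_⟩
    simp only [H x (right_ne_zero_of_mul hx)]
    exact div_ne_zero (left_ne_zero_of_mul hx) (right_ne_zero_of_mul hx)

end IsRationalFun

namespace IsRationalMap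

theorem of_real {f : E → ℝ} (hf : IsRationalFun f) : IsRationalMap f := fun l => by
  have h : (fun x => l (f x)) = fun x => f x * l 1 := funext fun x => by
    rw [← smul_eq_mul, ← map_smul, smul_eq_mul, mul_one]
  rw [h]
  exact hf.mul (.const _)

theorem pi {ι : Type*} [Fintype ι] {f : E → ι → F} (hf : ∀ i, IsRationalMap fun x => f x i) :
    IsRationalMap f := fun l => by
  classical
  have h : (fun x => l (f x)) = fun x => ∑ i, (l ∘ₗ LinearMap.single ℝ (fun _ => F) i) (f x i) :=
    funext fun x => by
      simp only [LinearMap.comp_apply, ← map_sum, LinearMap.coe_single, Finset.univ_sum_single]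
  rw [h]
  exact .sum _ fun i => hf i _

end IsRationalMap

end Algebra

/-- The measure `|ρ| dx` has the same null sets as `dx` if `ρ` is nonzero almost everywhere. -/
theorem ae_densityMeasure_iff {E : Type*} [MeasureSpace E] {ρ : E → ℝ} (hm : Measurable ρ) (h : ∀ᵐ x, ρ x ≠ 0)
    {P : E → Prop} : (∀ᵐ x ∂densityMeasure ρ, P x) ↔ ∀ᵐ x, P x := by
  rw [densityMeasure, ae_withDensity_iff (by fun_prop)]
  refine ⟨fun H => ?_, fun H => H.mono fun x hx _ => hx⟩
  filter_upwards [H, h] with x hx hx'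
  exact hx (by simpa using hx')

theorem quasiMeasurePreserving_of_densityMeasure {E : Type*} [MeasureSpace E] {ρ : E → ℝ} (hm : Measurable ρ)
    (h : ∀ᵐ x, ρ x ≠ 0) {f : E → E}
    (hf : MeasurePreserving f (densityMeasure ρ) (densityMeasure ρ)) :
    Measure.QuasiMeasurePreserving f := by
  refine ⟨hf.measurable, Measure.AbsolutelyContinuous.mk fun s hs h0 => ?_⟩
  rw [Measure.map_apply hf.measurable hs]
  have h1 : ∀ᵐ x ∂densityMeasure ρ, x ∉ s :=
    (ae_densityMeasure_iff hm h).2 (measure_eq_zero_iff_ae_notMem.1 h0)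
  exact measure_eq_zero_iff_ae_notMem.2
    ((ae_densityMeasure_iff hm h).1 (hf.quasiMeasurePreserving.ae h1))

/-! ### Generic sets, null sets and composition of rational maps. -/

section Measure

variable {E F : Type*} [NormedAddCommGroup E] [NormedSpace ℝ E] [FiniteDimensional ℝ E]
  [NormedAddCommGroup F] [NormedSpace ℝ F] [FiniteDimensional ℝ F]

theorem IsPolynomialFun.continuous {p : E → ℝ} (hp : IsPolynomialFun p) : Continuous p := by
  refine Algebra.adjoin_induction (p := fun p _ => Continuous p) ?_ ?_ ?_ ?_ hp
  · rintro _ ⟨l, rfl⟩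
    exact l.continuous_of_finiteDimensional
  · exact fun r => continuous_const
  · exact fun p q _ _ h1 h2 => h1.add h2
  · exact fun p q _ _ h1 h2 => h1.mul h2

variable [MeasureSpace E] [BorelSpace E] [(volume : Measure E).IsAddHaarMeasure]
  [MeasureSpace F] [BorelSpace F] [(volume : Measure F).IsAddHaarMeasure]

/-- The zero set of a nonzero polynomial function is a null set. -/
theorem IsPolynomialFun.ae_ne_zero {p : E → ℝ} (hp : IsPolynomialFun p) (hp0 : p ≠ 0) :
    ∀ᵐ x, p x ≠ 0 := by
  obtain ⟨x₀, hx₀⟩ := Function.ne_iff.1 hp0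
  have hc : Continuous fun z : E × ℝ => p (x₀ + z.2 • z.1) :=
    hp.continuous.comp (by fun_prop)
  -- Every line through x₀ meets the zero set in finitely many points. After exchanging quantifiers
  -- by Fubini, one nonzero t works for almost every direction, and x ↦ x₀ + t x preserves null sets
  -- in both directions.
  have h1 : ∀ᵐ x : E, ∀ᵐ t : ℝ, p (x₀ + t • x) ≠ 0 := ae_of_all _ fun x => by
    have := (hp.finite_zeros_line hx₀ x).measure_zero volume
    simpa [ae_iff] using this
  have h2 : ∀ᵐ t : ℝ, ∀ᵐ x : E, p (x₀ + t • x) ≠ 0 :=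
    (Measure.ae_ae_comm (p := fun (x : E) (t : ℝ) => p (x₀ + t • x) ≠ 0)
      (isOpen_ne_fun hc continuous_const).measurableSet).1 h1
  obtain ⟨t, ht, ht0⟩ := (h2.and (Measure.ae_ne volume (0 : ℝ))).exists
  rw [ae_iff] at ht ⊢
  have h3 := Measure.addHaar_preimage_smul (volume : Measure E) ht0 {x | ¬p (x₀ + x) ≠ 0}
  rw [Set.preimage_ofPred_eq, ht] at h3
  have h4 : volume {x | ¬p (x₀ + x) ≠ 0} = 0 := by
    rcases mul_eq_zero.1 h3.symm with h | h
    · exact absurd h (by simp [ht0])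
    · exact h
  rwa [← measure_preimage_add volume x₀ {x | ¬p x ≠ 0}]

theorem Generically.ae {P : E → Prop} (h : Generically P) : ∀ᵐ x, P x := by
  obtain ⟨p, hp, hp0, H⟩ := h
  exact (hp.ae_ne_zero hp0).mono H

/-- A rational function that is nonzero almost everywhere is generically nonzero. -/
theorem IsRationalFun.generically_ne_zero {f : E → ℝ} (hf : IsRationalFun f)
    (h : ∀ᵐ x, f x ≠ 0) : Generically fun x => f x ≠ 0 := by
  refine hf.exists_num_ne_zero.resolve_right fun h0 => ?_
  obtain ⟨x, hx, hx'⟩ := (h.and h0.ae).exists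
  exact hx hx'

/-- Generic properties pull back under rational maps that do not charge null sets. -/
theorem Generically.comp {P : F → Prop} (h : Generically P) {f : E → F} (hf : IsRationalMap f)
    (hq : Measure.QuasiMeasurePreserving f) : Generically fun x => P (f x) := by
  obtain ⟨p, hp, hp0, H⟩ := h
  exact ((IsRationalFun.comp_polynomial hf hp).generically_ne_zero
    (hq.ae (hp.ae_ne_zero hp0))).mono fun x hx => H _ hx

/-- Without the hypothesis on null sets, the image of f could lie in the zero set of the denominator
of r, where the values of r are arbitrary. -/
theorem IsRationalFun.comp {r : F → ℝ} (hr : IsRationalFun r) {f : E → F} (hf : IsRationalMap f)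
    (hq : Measure.QuasiMeasurePreserving f) : IsRationalFun fun x => r (f x) := by
  obtain ⟨p, q, hp, hq', hq0, H⟩ := hr
  exact ((IsRationalFun.comp_polynomial hf hp).div (IsRationalFun.comp_polynomial hf hq')).congr
    (Generically.comp (P := fun y => r y = p y / q y) ⟨q, hq', hq0, H⟩ hf hq)

theorem IsRationalMap.comp {G : Type*} [AddCommGroup G] [Module ℝ G] {g : F → G}
    (hg : IsRationalMap g) {f : E → F} (hf : IsRationalMap f)
    (hq : Measure.QuasiMeasurePreserving f) : IsRationalMap fun x => g (f x) :=
  fun l => (hg l).comp hf hq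

end Measure

/-! ### The polar map of a binary quartic in coordinates

The quartic enters through the coefficients `e 0, …, e 4` of its fourth derivative, and
`x₀ = (p, q)`, `x₁ = (u, v)`. -/

section Scalar

/-- The entries of the Hessian of the quartic, polarized at `(p, q)` and `(u, v)`. -/
def quarticHess (e : ℕ → ℝ) (k : ℕ) (p q u v : ℝ) : ℝ :=
  e k * (p * u) + e (k + 1) * (p * v + q * u) + e (k + 2) * (q * v)

/-- The determinant of the linear system. -/
def polarDet (e : ℕ → ℝ) (p q u v : ℝ) : ℝ :=
  1 + quarticHess e 0 p q u v * quarticHess e 2 p q u v - quarticHess e 1 p q u v ^ 2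

/-- The numerator of the first coordinate of `x₂`. -/
def polarNumX (e : ℕ → ℝ) (p q u v : ℝ) : ℝ :=
  p - quarticHess e 1 p q u v * p - quarticHess e 2 p q u v * q

/-- The numerator of the second coordinate of `x₂`. -/
def polarNumY (e : ℕ → ℝ) (p q u v : ℝ) : ℝ :=
  q + quarticHess e 0 p q u v * p + quarticHess e 1 p q u v * q

/-- The first coordinate of `x₂`. -/
noncomputable def polarX (e : ℕ → ℝ) (p q u v : ℝ) : ℝ := polarNumX e p q u v / polarDet e p q u v

/-- The second coordinate of `x₂`. -/
noncomputable def polarY (e : ℕ → ℝ) (p q u v : ℝ) : ℝ := polarNumY e p q u v / polarDet e p q u v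

variable (e : ℕ → ℝ) (p q u v : ℝ)

theorem quarticHess_smul {c d : ℝ} (hcd : c * d = 1) (k : ℕ) :
    quarticHess e k (c * p) (c * q) (d * u) (d * v) = quarticHess e k p q u v := by
  unfold quarticHess
  linear_combination (e k * (p * u) + e (k + 1) * (p * v + q * u) + e (k + 2) * (q * v)) * hcd

theorem polarDet_smul {c d : ℝ} (hcd : c * d = 1) :
    polarDet e (c * p) (c * q) (d * u) (d * v) = polarDet e p q u v := by
  simp only [polarDet, quarticHess_smul e p q u v hcd]

/-- The matrix of the system is unchanged and its right-hand side is multiplied by c. No regularity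
is needed: where the determinant vanishes both sides are 0 by the convention for division by zero.
-/
theorem polarX_smul {c d : ℝ} (hcd : c * d = 1) :
    polarX e (c * p) (c * q) (d * u) (d * v) = c * polarX e p q u v := by
  simp only [polarX, polarNumX, polarDet_smul e p q u v hcd, quarticHess_smul e p q u v hcd]
  ring

theorem polarY_smul {c d : ℝ} (hcd : c * d = 1) :
    polarY e (c * p) (c * q) (d * u) (d * v) = c * polarY e p q u v := by
  simp only [polarY, polarNumY, polarDet_smul e p q u v hcd, quarticHess_smul e p q u v hcd]
  ring

theorem quarticHess_comm (k : ℕ) : quarticHess e k u v p q = quarticHess e k p q u v := by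
  unfold quarticHess; ring

theorem polarDet_comm : polarDet e u v p q = polarDet e p q u v := by
  simp only [polarDet, quarticHess_comm e p q u v]

theorem quarticHess_neg (k : ℕ) : quarticHess (-e) k p q u v = -quarticHess e k p q u v := by
  simp only [quarticHess, Pi.neg_apply]; ring

/-- Negating e reverses the time step. The matrix A is traceless, so I - A and I + A have the same
determinant. -/
theorem polarDet_neg : polarDet (-e) p q u v = polarDet e p q u v := by
  simp only [polarDet, quarticHess_neg]; ring

/-- The linear system, solved for `x₀` by the symmetry of the polarization. -/
theorem polar_symm (P Q : ℝ) :
    quarticHess e 1 p q u v * P + quarticHess e 2 p q u v * Q =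
        quarticHess e 1 u v P Q * p + quarticHess e 2 u v P Q * q ∧
      quarticHess e 0 p q u v * P + quarticHess e 1 p q u v * Q =
        quarticHess e 0 u v P Q * p + quarticHess e 1 u v P Q * q := by
  constructor <;> (unfold quarticHess; ring)

variable {e p q u v}

/-- The linear system that defines `x₂`. -/
theorem polar_system (hD : polarDet e p q u v ≠ 0) :
    polarX e p q u v + (quarticHess e 1 p q u v * polarX e p q u v +
        quarticHess e 2 p q u v * polarY e p q u v) = p ∧
      polarY e p q u v - (quarticHess e 0 p q u v * polarX e p q u v +
        quarticHess e 1 p q u v * polarY e p q u v) = q := by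
  have h1 : polarX e p q u v * polarDet e p q u v = polarNumX e p q u v := div_mul_cancel₀ _ hD
  have h2 : polarY e p q u v * polarDet e p q u v = polarNumY e p q u v := div_mul_cancel₀ _ hD
  have h3 : polarDet e p q u v = 1 + quarticHess e 0 p q u v * quarticHess e 2 p q u v -
    quarticHess e 1 p q u v ^ 2 := rfl
  unfold polarNumX at h1
  unfold polarNumY at h2
  constructor <;> apply mul_right_cancel₀ hD
  · linear_combination (1 + quarticHess e 1 p q u v) * h1 + quarticHess e 2 p q u v * h2 - p * h3
  · linear_combination (1 - quarticHess e 1 p q u v) * h2 - quarticHess e 0 p q u v * h1 - q * h3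

/-- The adjoint linear system. -/
theorem polar_system' (hD : polarDet e p q u v ≠ 0) {P Q : ℝ} (hP : polarX e p q u v = P)
    (hQ : polarY e p q u v = Q) :
    p - quarticHess e 1 u v P Q * p - quarticHess e 2 u v P Q * q = P ∧
      q + quarticHess e 0 u v P Q * p + quarticHess e 1 u v P Q * q = Q := by
  obtain ⟨h1, h2⟩ := polar_system hD
  rw [hP, hQ] at h1 h2
  obtain ⟨h3, h4⟩ := polar_symm e p q u v P Q
  constructor <;> linarith

/-- With A = A(x₁, x₂), the adjoint system is (I + A) x₀ = x₂. Multiplication by I - A, the adjugate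
of I + A, yields D(x₁, x₂) x₀. -/
theorem polar_backward (hD : polarDet e p q u v ≠ 0) {P Q : ℝ} (hP : polarX e p q u v = P)
    (hQ : polarY e p q u v = Q) :
    P + quarticHess e 1 u v P Q * P + quarticHess e 2 u v P Q * Q = p * polarDet e u v P Q ∧
      Q - quarticHess e 0 u v P Q * P - quarticHess e 1 u v P Q * Q =
        q * polarDet e u v P Q := by
  obtain ⟨h1, h2⟩ := polar_system' hD hP hQ
  unfold polarDet
  constructor
  · linear_combination -(1 + quarticHess e 1 u v P Q) * h1 - quarticHess e 2 u v P Q * h2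
  · linear_combination quarticHess e 0 u v P Q * h1 - (1 - quarticHess e 1 u v P Q) * h2

/-- Reversing the time step inverts the map. -/
theorem polar_neg_polar (hD : polarDet e p q u v ≠ 0) {P Q : ℝ} (hP : polarX e p q u v = P)
    (hQ : polarY e p q u v = Q) (hD' : polarDet e u v P Q ≠ 0) :
    polarX (-e) P Q u v = p ∧ polarY (-e) P Q u v = q := by
  obtain ⟨h1, h2⟩ := polar_backward hD hP hQ
  have h3 := polarDet_comm e u v P Q
  have h4 := polarDet_neg e P Q u v
  simp only [polarX, polarY, h4, h3, div_eq_iff hD', polarNumX, polarNumY, quarticHess_neg,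
    quarticHess_comm e u v P Q]
  constructor <;> linarith

/-- The symplectic area of consecutive points has period two. -/
theorem polar_area (hD : polarDet e p q u v ≠ 0) {P Q : ℝ} (hP : polarX e p q u v = P)
    (hQ : polarY e p q u v = Q) (hD' : polarDet e u v P Q ≠ 0) :
    P * polarY e u v P Q - Q * polarX e u v P Q = p * v - q * u := by
  obtain ⟨h1, h2⟩ := polar_backward hD hP hQ
  have h3 : polarX e u v P Q * polarDet e u v P Q = polarNumX e u v P Q := div_mul_cancel₀ _ hD'
  have h4 : polarY e u v P Q * polarDet e u v P Q = polarNumY e u v P Q := div_mul_cancel₀ _ hD'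
  unfold polarNumX at h3
  unfold polarNumY at h4
  apply mul_right_cancel₀ hD'
  -- With A = A(x₁, x₂) and D = D(x₁, x₂), this is D ω(x₂, x₃) = ω(x₂, (I + A) x₁) = ω((I - A) x₂,
  -- x₁) = D ω(x₀, x₁).
  linear_combination P * h4 - Q * h3 + v * h1 - u * h2

/-- The determinant at the image point, multiplied by the square of the determinant. -/
theorem polarDet_next (hD : polarDet e p q u v ≠ 0) :
    polarDet e u v (polarX e p q u v) (polarY e p q u v) * polarDet e p q u v ^ 2 =
      polarDet e p q u v ^ 2 +
        (quarticHess e 0 u v (polarNumX e p q u v) (polarNumY e p q u v) *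
          quarticHess e 2 u v (polarNumX e p q u v) (polarNumY e p q u v) -
        quarticHess e 1 u v (polarNumX e p q u v) (polarNumY e p q u v) ^ 2) := by
  have h1 : polarX e p q u v * polarDet e p q u v = polarNumX e p q u v := div_mul_cancel₀ _ hD
  have h2 : polarY e p q u v * polarDet e p q u v = polarNumY e p q u v := div_mul_cancel₀ _ hD
  rw [← h1, ← h2]
  simp only [polarDet.eq_def e u v, quarticHess]
  ring

end Scalar

/-! ### Partial derivatives -/

section Partials

variable {n : ℕ}

/-- The function `f` is differentiable at `x` with partial derivatives `g`. -/
def HasPartialsAt (f : (Fin n → ℝ) → ℝ) (g : Fin n → ℝ) (x : Fin n → ℝ) : Prop :=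
  ∃ L : (Fin n → ℝ) →L[ℝ] ℝ, HasFDerivAt f L x ∧ ∀ v, L v = g ⬝ᵥ v

namespace HasPartialsAt

variable {f f' : (Fin n → ℝ) → ℝ} {g g' x : Fin n → ℝ}

theorem const (c : ℝ) : HasPartialsAt (fun _ => c) 0 x :=
  ⟨0, hasFDerivAt_const c x, by simp⟩

theorem coord (i : Fin n) : HasPartialsAt (fun x => x i) (Pi.single i 1) x :=
  ⟨_, hasFDerivAt_apply i x, by simp⟩

theorem add (hf : HasPartialsAt f g x) (hf' : HasPartialsAt f' g' x) :
    HasPartialsAt (fun x => f x + f' x) (g + g') x := by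
  obtain ⟨L, h, hL⟩ := hf
  obtain ⟨L', h', hL'⟩ := hf'
  exact ⟨_, h.add h', by simp [hL, hL', add_dotProduct]⟩

theorem sub (hf : HasPartialsAt f g x) (hf' : HasPartialsAt f' g' x) :
    HasPartialsAt (fun x => f x - f' x) (g - g') x := by
  obtain ⟨L, h, hL⟩ := hf
  obtain ⟨L', h', hL'⟩ := hf'
  exact ⟨_, h.sub h', by simp [hL, hL', sub_dotProduct]⟩

theorem mul (hf : HasPartialsAt f g x) (hf' : HasPartialsAt f' g' x) :
    HasPartialsAt (fun x => f x * f' x) (f x • g' + f' x • g) x := by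
  obtain ⟨L, h, hL⟩ := hf
  obtain ⟨L', h', hL'⟩ := hf'
  exact ⟨_, h.mul h', by simp [hL, hL', add_dotProduct]⟩

theorem inv (hf : HasPartialsAt f g x) (h0 : f x ≠ 0) :
    HasPartialsAt (fun x => (f x)⁻¹) (-(f x ^ 2)⁻¹ • g) x := by
  obtain ⟨L, h, hL⟩ := hf
  exact ⟨_, (hasDerivAt_inv h0).comp_hasFDerivAt x h, by simp [hL]⟩

theorem congr_partials (hf : HasPartialsAt f g x) (h : ∀ i, g i = g' i) : HasPartialsAt f g' x := by
  rwa [← funext h]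

theorem div (hf : HasPartialsAt f g x) (hf' : HasPartialsAt f' g' x) (h0 : f' x ≠ 0) :
    HasPartialsAt (fun x => f x / f' x) ((f' x)⁻¹ • (g - (f x / f' x) • g')) x := by
  simp only [div_eq_mul_inv]
  refine (hf.mul (hf'.inv h0)).congr_partials fun i => ?_
  simp
  field_simp
  ring

theorem unique_of_eventuallyEq (hf : HasPartialsAt f g x) (hf' : HasPartialsAt f' g' x)
    (h : f =ᶠ[nhds x] f') (i : Fin n) : g i = g' i := by
  obtain ⟨L, h1, hL⟩ := hf
  obtain ⟨L', h1', hL'⟩ := hf'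
  have h2 : L = L' := h1.unique (h1'.congr_of_eventuallyEq h)
  simpa [h2, hL'] using (hL (Pi.single i 1)).symm

theorem differentiableAt (hf : HasPartialsAt f g x) : DifferentiableAt ℝ f x := by
  obtain ⟨L, h, -⟩ := hf
  exact h.differentiableAt

theorem fderiv_apply (hf : HasPartialsAt f g x) (v : Fin n → ℝ) : fderiv ℝ f x v = g ⬝ᵥ v := by
  obtain ⟨L, h, hL⟩ := hf
  rw [h.fderiv, hL]

theorem pi {m : ℕ} {f : (Fin n → ℝ) → Fin m → ℝ} {M : Matrix (Fin m) (Fin n) ℝ}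
    (h : ∀ i, HasPartialsAt (fun x => f x i) (M i) x) :
    HasFDerivAt f (LinearMap.toContinuousLinearMap (Matrix.toLin' M)) x := by
  choose L h hL using h
  refine (hasFDerivAt_pi.2 h).congr_fderiv ?_
  ext v i
  simp [hL, Matrix.mulVec]

end HasPartialsAt

end Partials

/-! ### Implicit differentiation of the linear system. -/

section PolarPartials

variable {n : ℕ} {p q u v : (Fin n → ℝ) → ℝ} {p' q' u' v' x : Fin n → ℝ}

theorem HasPartialsAt.quarticHess (hp : HasPartialsAt p p' x) (hq : HasPartialsAt q q' x)
    (hu : HasPartialsAt u u' x) (hv : HasPartialsAt v v' x) (e : ℕ → ℝ) (k : ℕ) :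
    HasPartialsAt (fun x => quarticHess e k (p x) (q x) (u x) (v x))
      (fun i => quarticHess e k (p' i) (q' i) (u x) (v x) +
        quarticHess e k (p x) (q x) (u' i) (v' i)) x := by
  unfold _root_.quarticHess
  refine ((((HasPartialsAt.const (e k)).mul (hp.mul hu)).add
    ((HasPartialsAt.const (e (k + 1))).mul ((hp.mul hv).add (hq.mul hu)))).add
      ((HasPartialsAt.const (e (k + 2))).mul (hq.mul hv))).congr_partials fun i => ?_
  simp
  ring

/-- The derivatives of the polar map solve the linearized system. -/
theorem exists_hasPartialsAt_polar (hp : HasPartialsAt p p' x) (hq : HasPartialsAt q q' x)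
    (hu : HasPartialsAt u u' x) (hv : HasPartialsAt v v' x) (e : ℕ → ℝ)
    (hD : polarDet e (p x) (q x) (u x) (v x) ≠ 0) {b : ℕ → ℝ}
    (hb : ∀ k, b k = quarticHess e k (p x) (q x) (u x) (v x)) {P Q : ℝ}
    (hP : P = polarX e (p x) (q x) (u x) (v x)) (hQ : Q = polarY e (p x) (q x) (u x) (v x)) :
    ∃ P' Q' : Fin n → ℝ,
      HasPartialsAt (fun x => polarX e (p x) (q x) (u x) (v x)) P' x ∧
      HasPartialsAt (fun x => polarY e (p x) (q x) (u x) (v x)) Q' x ∧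
      ∀ i, (1 + b 1) * P' i + b 2 * Q' i = p' i -
          (quarticHess e 1 (u x) (v x) P Q * p' i + quarticHess e 2 (u x) (v x) P Q * q' i) -
          (quarticHess e 1 (p x) (q x) P Q * u' i + quarticHess e 2 (p x) (q x) P Q * v' i) ∧
        (1 - b 1) * Q' i - b 0 * P' i = q' i +
          (quarticHess e 0 (u x) (v x) P Q * p' i + quarticHess e 1 (u x) (v x) P Q * q' i) +
          (quarticHess e 0 (p x) (q x) P Q * u' i + quarticHess e 1 (p x) (q x) P Q * v' i) := by
  have h0 := hp.quarticHess hq hu hv e 0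
  have h1 := hp.quarticHess hq hu hv e 1
  have h2 := hp.quarticHess hq hu hv e 2
  obtain ⟨D', hdet⟩ : ∃ D', HasPartialsAt (fun x => polarDet e (p x) (q x) (u x) (v x)) D' x := by
    simp only [polarDet, sq]
    exact ⟨_, ((HasPartialsAt.const 1).add (h0.mul h2)).sub (h1.mul h1)⟩
  obtain ⟨P', hX⟩ : ∃ P', HasPartialsAt (fun x => polarX e (p x) (q x) (u x) (v x)) P' x :=
    ⟨_, ((hp.sub (h1.mul hp)).sub (h2.mul hq)).div hdet hD⟩
  obtain ⟨Q', hY⟩ : ∃ Q', HasPartialsAt (fun x => polarY e (p x) (q x) (u x) (v x)) Q' x :=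
    ⟨_, ((hq.add (h0.mul hp)).add (h1.mul hq)).div hdet hD⟩
  have hev := hdet.differentiableAt.continuousAt.eventually_ne hD
  refine ⟨P', Q', hX, hY, fun i => ⟨?_, ?_⟩⟩
  -- The system holds in a neighbourhood of the point, so both sides have the same partials there.
  -- The quantities b, P, Q are variables so that they stay opaque when the other Hessian entries
  -- are unfolded and rearranged by symmetry.
  · have h := (hX.add ((h1.mul hX).add (h2.mul hY))).unique_of_eventuallyEq hp
      (hev.mono fun y hy => (polar_system hy).1) i
    simp only [Pi.smul_apply, Pi.add_apply, smul_eq_mul, ← hb, ← hP, ← hQ] at h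
    unfold quarticHess at h ⊢
    linear_combination h
  · have h := (hY.sub ((h0.mul hX).add (h1.mul hY))).unique_of_eventuallyEq hq
      (hev.mono fun y hy => (polar_system hy).2) i
    simp only [Pi.smul_apply, Pi.add_apply, Pi.sub_apply, smul_eq_mul, ← hb, ← hP, ← hQ] at h
    unfold quarticHess at h ⊢
    linear_combination h

end PolarPartials

/-! ### The invariant measure -/

section PlaneStep

/-- The map `x₀ ↦ x₂` for fixed `x₁ = (u, v)`. -/
noncomputable def polarPlane (e : ℕ → ℝ) (u v : ℝ) (x : Fin 2 → ℝ) : Fin 2 → ℝ :=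
  ![polarX e (x 0) (x 1) u v, polarY e (x 0) (x 1) u v]

/-- The set where both the map `x₀ ↦ x₂` and its inverse are regular. -/
def polarPlaneDomain (e : ℕ → ℝ) (u v : ℝ) : Set (Fin 2 → ℝ) :=
  {x | polarDet e (x 0) (x 1) u v ≠ 0 ∧
    polarDet e u v (polarX e (x 0) (x 1) u v) (polarY e (x 0) (x 1) u v) ≠ 0}

variable (e : ℕ → ℝ) (u v : ℝ)

/-- At fixed x₁ the linearized system is (I - A(x₀, x₁)) dx₂ = (I + A(x₁, x₂)) dx₀; the claim is its
determinant. -/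
theorem exists_hasFDerivAt_polarPlane {x : Fin 2 → ℝ}
    (hD : polarDet e (x 0) (x 1) u v ≠ 0) :
    ∃ L : (Fin 2 → ℝ) →L[ℝ] Fin 2 → ℝ, HasFDerivAt (polarPlane e u v) L x ∧
      polarDet e (x 0) (x 1) u v * L.det =
        polarDet e u v (polarX e (x 0) (x 1) u v) (polarY e (x 0) (x 1) u v) := by
  obtain ⟨P', Q', hP', hQ', hr⟩ := exists_hasPartialsAt_polar (HasPartialsAt.coord (x := x) 0)
    (.coord 1) (.const u) (.const v) e hD (fun k => rfl) rfl rfl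
  refine ⟨_, HasPartialsAt.pi (f := polarPlane e u v) (M := Matrix.of ![P', Q']) fun i => ?_, ?_⟩
  · fin_cases i
    · exact hP'
    · exact hQ'
  rw [ContinuousLinearMap.det, LinearMap.coe_toContinuousLinearMap, LinearMap.det_toLin',
    Matrix.det_fin_two]
  obtain ⟨r1, r2⟩ := hr 0
  obtain ⟨r3, r4⟩ := hr 1
  simp at r1 r2 r3 r4 ⊢
  unfold polarDet
  linear_combination r1 * ((1 - quarticHess e 1 (x 0) (x 1) u v) * Q' 1 -
    quarticHess e 0 (x 0) (x 1) u v * P' 1) + (1 - quarticHess e 1 u v (polarX e (x 0) (x 1) u v)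
    (polarY e (x 0) (x 1) u v)) * r4 - r3 * ((1 - quarticHess e 1 (x 0) (x 1) u v) * Q' 0 -
    quarticHess e 0 (x 0) (x 1) u v * P' 0) + quarticHess e 2 u v (polarX e (x 0) (x 1) u v)
    (polarY e (x 0) (x 1) u v) * r2

/-- Time reversal exchanges the two determinants in the definition of the domain. The domain is thus
carried bijectively onto the one for -e, as the change of variables requires. -/
theorem polarPlane_mem {x : Fin 2 → ℝ} (hx : x ∈ polarPlaneDomain e u v) :
    polarPlane e u v x ∈ polarPlaneDomain (-e) u v ∧
      polarPlane (-e) u v (polarPlane e u v x) = x := by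
  obtain ⟨h1, h2⟩ := hx
  obtain ⟨h3, h4⟩ := polar_neg_polar h1 rfl rfl h2
  refine ⟨⟨?_, ?_⟩, ?_⟩
  · simpa [polarPlane, polarDet_neg, polarDet_comm e u v] using h2
  · simpa [polarPlane, polarDet_neg, polarDet_comm e u v, h3, h4] using h1
  · ext i
    fin_cases i
    · simpa [polarPlane] using h3
    · simpa [polarPlane] using h4

theorem image_polarPlane :
    polarPlane e u v '' polarPlaneDomain e u v = polarPlaneDomain (-e) u v := by
  ext y
  constructor
  · rintro ⟨x, hx, rfl⟩
    exact (polarPlane_mem e u v hx).1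
  · intro hy
    have h := polarPlane_mem (-e) u v hy
    rw [neg_neg] at h
    exact ⟨_, h.1, h.2⟩

theorem injOn_polarPlane : Set.InjOn (polarPlane e u v) (polarPlaneDomain e u v) := by
  intro x hx y hy h
  rw [← (polarPlane_mem e u v hx).2, h, (polarPlane_mem e u v hy).2]

theorem isPolynomialFun_quarticHess {E : Type*} [AddCommGroup E] [Module ℝ E] {p q u v : E → ℝ}
    (hp : IsPolynomialFun p) (hq : IsPolynomialFun q) (hu : IsPolynomialFun u)
    (hv : IsPolynomialFun v) (k : ℕ) :
    IsPolynomialFun fun x => quarticHess e k (p x) (q x) (u x) (v x) :=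
  (((IsPolynomialFun.const _).mul (hp.mul hu)).add
    ((IsPolynomialFun.const _).mul ((hp.mul hv).add (hq.mul hu)))).add
      ((IsPolynomialFun.const _).mul (hq.mul hv))

theorem isPolynomialFun_polarDet {E : Type*} [AddCommGroup E] [Module ℝ E] {p q u v : E → ℝ}
    (hp : IsPolynomialFun p) (hq : IsPolynomialFun q) (hu : IsPolynomialFun u)
    (hv : IsPolynomialFun v) :
    IsPolynomialFun fun x => polarDet e (p x) (q x) (u x) (v x) :=
  ((IsPolynomialFun.const _).add ((isPolynomialFun_quarticHess e hp hq hu hv 0).mul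
    (isPolynomialFun_quarticHess e hp hq hu hv 2))).sub
      ((isPolynomialFun_quarticHess e hp hq hu hv 1).pow 2)

theorem isPolynomialFun_polarNumX {E : Type*} [AddCommGroup E] [Module ℝ E] {p q u v : E → ℝ}
    (hp : IsPolynomialFun p) (hq : IsPolynomialFun q) (hu : IsPolynomialFun u)
    (hv : IsPolynomialFun v) :
    IsPolynomialFun fun x => polarNumX e (p x) (q x) (u x) (v x) :=
  (hp.sub ((isPolynomialFun_quarticHess e hp hq hu hv 1).mul hp)).sub
    ((isPolynomialFun_quarticHess e hp hq hu hv 2).mul hq)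

theorem isPolynomialFun_polarNumY {E : Type*} [AddCommGroup E] [Module ℝ E] {p q u v : E → ℝ}
    (hp : IsPolynomialFun p) (hq : IsPolynomialFun q) (hu : IsPolynomialFun u)
    (hv : IsPolynomialFun v) :
    IsPolynomialFun fun x => polarNumY e (p x) (q x) (u x) (v x) :=
  (hq.add ((isPolynomialFun_quarticHess e hp hq hu hv 0).mul hp)).add
    ((isPolynomialFun_quarticHess e hp hq hu hv 1).mul hq)

/-- Both the determinant and the determinant at the image point are generically nonzero. -/
theorem generically_polarDet_ne_zero {E : Type*} [AddCommGroup E] [Module ℝ E] {p q u v : E → ℝ}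
    (hp : IsPolynomialFun p) (hq : IsPolynomialFun q) (hu : IsPolynomialFun u)
    (hv : IsPolynomialFun v) {x₀ : E} (h₀ : p x₀ = 0 ∧ q x₀ = 0 ∨ u x₀ = 0 ∧ v x₀ = 0) :
    Generically fun x => polarDet e (p x) (q x) (u x) (v x) ≠ 0 ∧
      polarDet e (u x) (v x) (polarX e (p x) (q x) (u x) (v x))
        (polarY e (p x) (q x) (u x) (v x)) ≠ 0 := by
  have hX := isPolynomialFun_polarNumX e hp hq hu hv
  have hY := isPolynomialFun_polarNumY e hp hq hu hv
  have hD := isPolynomialFun_polarDet e hp hq hu hv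
  have h1 := Generically.polynomial_ne_zero hD (x := x₀) (by
    rcases h₀ with ⟨h, h'⟩ | ⟨h, h'⟩ <;> simp [polarDet, quarticHess, h, h'])
  -- The determinant at the image point is only rational; `polarDet_next` clears its denominator by
  -- the factor D². At a base point with x₀ = 0 or x₁ = 0 all relevant Hessian entries vanish, and
  -- both polynomials equal 1.
  have h2 := Generically.polynomial_ne_zero ((hD.pow 2).add
    (((isPolynomialFun_quarticHess e hu hv hX hY 0).mul
      (isPolynomialFun_quarticHess e hu hv hX hY 2)).sub
      ((isPolynomialFun_quarticHess e hu hv hX hY 1).pow 2))) (x := x₀) (by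
    rcases h₀ with ⟨h, h'⟩ | ⟨h, h'⟩ <;>
      simp [polarDet, quarticHess, polarNumX, polarNumY, h, h'])
  refine (h1.and h2).mono fun x hx => ⟨hx.1, ?_⟩
  have := hx.2
  rw [← polarDet_next hx.1] at this
  exact left_ne_zero_of_mul this

theorem continuous_polarDet : Continuous fun x : ℝ × ℝ × ℝ × ℝ =>
    polarDet e x.1 x.2.1 x.2.2.1 x.2.2.2 := by
  unfold polarDet quarticHess
  fun_prop

theorem measurableSet_polarPlaneDomain : MeasurableSet (polarPlaneDomain e u v) := by
  have h1 : Measurable fun x : Fin 2 → ℝ => polarDet e (x 0) (x 1) u v := by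
    unfold polarDet quarticHess
    fun_prop
  have h2 : Measurable fun x : Fin 2 → ℝ => polarDet e u v
      (polarX e (x 0) (x 1) u v) (polarY e (x 0) (x 1) u v) := by
    unfold polarX polarY polarNumX polarNumY polarDet quarticHess
    fun_prop
  exact (h1 (measurableSet_singleton 0).compl).inter (h2 (measurableSet_singleton 0).compl)

theorem ae_mem_polarPlaneDomain : ∀ᵐ x, x ∈ polarPlaneDomain e u v :=
  (generically_polarDet_ne_zero e (.coord 0) (.coord 1) (.const u) (.const v)
    (x₀ := (0 : Fin 2 → ℝ)) (by simp)).ae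

/-- The map `x₀ ↦ x₂` preserves the measure with density `1 / |D|`. -/
theorem lintegral_polarPlane (F : (Fin 2 → ℝ) → ENNReal) :
    ∫⁻ x : Fin 2 → ℝ, ENNReal.ofReal |1 / polarDet e (x 0) (x 1) u v| * F (polarPlane e u v x) =
      ∫⁻ x : Fin 2 → ℝ, ENNReal.ofReal |1 / polarDet e (x 0) (x 1) u v| * F x := by
  have h1 : ∀ e, volume.restrict (polarPlaneDomain e u v) = volume := fun e =>
    Measure.restrict_eq_self_of_ae_mem (ae_mem_polarPlaneDomain e u v)
  have h2 : ∀ x ∈ polarPlaneDomain e u v, ∃ L : (Fin 2 → ℝ) →L[ℝ] Fin 2 → ℝ,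
      HasFDerivAt (polarPlane e u v) L x ∧ polarDet e (x 0) (x 1) u v * L.det =
        polarDet e u v (polarX e (x 0) (x 1) u v) (polarY e (x 0) (x 1) u v) :=
    fun x hx => exists_hasFDerivAt_polarPlane e u v hx.1
  choose! L hL hdet using h2
  -- Both domains have null complement, so the left integral may be taken over the domain for e and
  -- the right one over its image, the domain for -e.
  rw [← h1 (-e)]
  conv_lhs => rw [h1 (-e), ← h1 e]
  rw [← image_polarPlane, lintegral_image_eq_lintegral_abs_det_fderiv_mul volume
    (measurableSet_polarPlaneDomain e u v) (fun x hx => (hL x hx).hasFDerivWithinAt)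
    (injOn_polarPlane e u v)]
  refine setLIntegral_congr_fun (measurableSet_polarPlaneDomain e u v) fun x hx => ?_
  -- The density at the image involves D(x₂, x₁) = D(x₁, x₂), which is D(x₀, x₁) times the Jacobian
  -- determinant, so the Jacobian cancels.
  have h3 : polarDet e (polarPlane e u v x 0) (polarPlane e u v x 1) u v =
      polarDet e (x 0) (x 1) u v * (L x).det := by
    rw [hdet x hx, polarDet_comm]
    rfl
  have h4 := hx.2
  rw [← hdet x hx] at h4
  simp only [h3, ← mul_assoc]
  rw [← ENNReal.ofReal_mul (abs_nonneg _), ← abs_mul]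
  congr 3
  have := left_ne_zero_of_mul h4
  have := right_ne_zero_of_mul h4
  field_simp

end PlaneStep

/-! ### Iterated integrals in coordinates. -/

section Coordinates

theorem lintegral_fin_two_pair {f : (Fin 2 → Fin 2 → ℝ) → ENNReal} (hf : Measurable f) :
    ∫⁻ x, f x = ∫⁻ a, ∫⁻ b, f ![a, b] := by
  have h := volume_preserving_piFinTwo fun _ : Fin 2 => Fin 2 → ℝ
  rw [← h.symm.lintegral_comp hf, Measure.volume_eq_prod, lintegral_prod]
  · rfl
  · exact (hf.comp (MeasurableEquiv.measurable _)).aemeasurable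

theorem lintegral_fin_two {f : (Fin 2 → ℝ) → ENNReal} (hf : Measurable f) :
    ∫⁻ x, f x = ∫⁻ a, ∫⁻ b, f ![a, b] := by
  have h := volume_preserving_piFinTwo fun _ : Fin 2 => ℝ
  rw [← h.symm.lintegral_comp hf, Measure.volume_eq_prod, lintegral_prod]
  · rfl
  · exact (hf.comp (MeasurableEquiv.measurable _)).aemeasurable

theorem measurable_cons_cons {α β : Type*} [MeasurableSpace α] [MeasurableSpace β] {f g : α → β}
    (hf : Measurable f) (hg : Measurable g) : Measurable fun x => ![f x, g x] := by
  refine measurable_pi_iff.2 fun i => ?_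
  fin_cases i
  · exact hf
  · exact hg

theorem measurable_cons_cons_cons {α β : Type*} [MeasurableSpace α] [MeasurableSpace β]
    {f g h : α → β} (hf : Measurable f) (hg : Measurable g) (hh : Measurable h) :
    Measurable fun x => ![f x, g x, h x] := by
  refine measurable_pi_iff.2 fun i => ?_
  fin_cases i
  · exact hf
  · exact hg
  · exact hh

theorem lintegral_fin_three {f : (Fin 3 → ℝ) → ENNReal} (hf : Measurable f) :
    ∫⁻ x, f x = ∫⁻ a, ∫⁻ b, ∫⁻ c, f ![a, b, c] := by
  have h := volume_preserving_piFinSuccAbove (fun _ : Fin 3 => ℝ) 0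
  rw [← h.symm.lintegral_comp hf, Measure.volume_eq_prod, lintegral_prod]
  · refine lintegral_congr fun a => ?_
    rw [lintegral_fin_two]
    · refine lintegral_congr fun b => lintegral_congr fun c => congrArg f ?_
      ext i
      fin_cases i <;> rfl
    · exact hf.comp ((MeasurableEquiv.measurable _).comp measurable_prodMk_left)
  · exact (hf.comp (MeasurableEquiv.measurable _)).aemeasurable

theorem lintegral_fin_two_fin_two {f : (Fin 2 → Fin 2 → ℝ) → ENNReal} (hf : Measurable f) :
    ∫⁻ x, f x = ∫⁻ p, ∫⁻ q, ∫⁻ u, ∫⁻ v, f ![![p, q], ![u, v]] := by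
  rw [lintegral_fin_two_pair hf, lintegral_fin_two]
  · refine lintegral_congr fun p => lintegral_congr fun q => ?_
    rw [lintegral_fin_two]
    exact hf.comp (measurable_cons_cons measurable_const measurable_id)
  · exact Measurable.lintegral_prod_right'
      (f := fun z : (Fin 2 → ℝ) × (Fin 2 → ℝ) => f ![z.1, z.2])
      (hf.comp (measurable_cons_cons measurable_fst measurable_snd))

theorem lintegral_comp_mul_left {c : ℝ} (hc : c ≠ 0) (f : ℝ → ENNReal) :
    ∫⁻ x, f (c * x) = ENNReal.ofReal |c⁻¹| * ∫⁻ x, f x := by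
  rw [← smul_eq_mul, ← lintegral_smul_measure, ← Real.map_volume_mul_left hc]
  exact (lintegral_map_equiv f (Homeomorph.mulLeft₀ c hc).toMeasurableEquiv).symm

theorem lintegral_fin_three_comp_mul {a b c : ℝ} (ha : a ≠ 0) (hb : b ≠ 0) (hc : c ≠ 0)
    (f : ℝ → ℝ → ℝ → ENNReal) :
    ∫⁻ x, ∫⁻ y, ∫⁻ z, f (a * x) (b * y) (c * z) =
      ENNReal.ofReal |(a * b * c)⁻¹| * ∫⁻ x, ∫⁻ y, ∫⁻ z, f x y z := by
  have h1 : ∀ x y, ∫⁻ z, f x y (c * z) = ENNReal.ofReal |c⁻¹| * ∫⁻ z, f x y z :=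
    fun x y => lintegral_comp_mul_left hc _
  have h2 : ∀ x, ∫⁻ y, ∫⁻ z, f x (b * y) z = ENNReal.ofReal |b⁻¹| * ∫⁻ y, ∫⁻ z, f x y z :=
    fun x => lintegral_comp_mul_left hb fun y => ∫⁻ z, f x y z
  have h3 : ∫⁻ x, ∫⁻ y, ∫⁻ z, f (a * x) y z = ENNReal.ofReal |a⁻¹| * ∫⁻ x, ∫⁻ y, ∫⁻ z, f x y z :=
    lintegral_comp_mul_left ha fun x => ∫⁻ y, ∫⁻ z, f x y z
  simp only [h1, h2, h3, lintegral_const_mul' _ _ ENNReal.ofReal_ne_top]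
  rw [← mul_assoc, ← mul_assoc, ← ENNReal.ofReal_mul (abs_nonneg _), ← ENNReal.ofReal_mul (by positivity), ← abs_mul,
    ← abs_mul]
  congr 3
  rw [mul_inv, mul_inv]
  ring

theorem lintegral_densityMeasure {E : Type*} [MeasureSpace E] {ρ : E → ℝ} (hρ : Measurable ρ)
    {F : E → ENNReal} (hF : Measurable F) :
    ∫⁻ x, F x ∂densityMeasure ρ = ∫⁻ x, ENNReal.ofReal |ρ x| * F x := by
  rw [densityMeasure, lintegral_withDensity_eq_lintegral_mul _ (by fun_prop) hF]
  rfl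

theorem measurePreserving_densityMeasure {E : Type*} [MeasureSpace E] {ρ : E → ℝ}
    (hρ : Measurable ρ) {f : E → E} (hf : Measurable f)
    (h : ∀ F : E → ENNReal, Measurable F →
      ∫⁻ x, ENNReal.ofReal |ρ x| * F (f x) = ∫⁻ x, ENNReal.ofReal |ρ x| * F x) :
    MeasurePreserving f (densityMeasure ρ) (densityMeasure ρ) := by
  refine ⟨hf, Measure.ext_of_lintegral _ fun F hF => ?_⟩
  rw [lintegral_map hF hf, lintegral_densityMeasure hρ (by fun_prop : Measurable fun x => F (f x)),
    lintegral_densityMeasure hρ hF, ← h F hF]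

end Coordinates

/-! ### The invariant measure on pairs of points and its disintegration along the scaling group. -/

section PolarStep

/-- The polar map in coordinates. -/
noncomputable def polarStep (e : ℕ → ℝ) (x : Fin 2 → Fin 2 → ℝ) : Fin 2 → Fin 2 → ℝ :=
  ![x 1, ![polarX e (x 0 0) (x 0 1) (x 1 0) (x 1 1), polarY e (x 0 0) (x 0 1) (x 1 0) (x 1 1)]]

/-- The density of the invariant measure. -/
noncomputable def polarDensity (e : ℕ → ℝ) (x : Fin 2 → Fin 2 → ℝ) : ℝ :=
  1 / polarDet e (x 0 0) (x 0 1) (x 1 0) (x 1 1)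

/-- The invariants of the scaling group. -/
noncomputable def scalingQuotient (x : Fin 2 → Fin 2 → ℝ) : Fin 3 → ℝ :=
  ![x 0 1 / x 0 0, x 0 0 * x 1 0, x 0 0 * x 1 1]

/-- The inverse of the invariants of the scaling group and the orbit coordinate. -/
noncomputable def scalingSection (z : (Fin 3 → ℝ) × ℝ) : Fin 2 → Fin 2 → ℝ :=
  ![![z.2, z.2 * z.1 0], ![z.1 1 / z.2, z.1 2 / z.2]]

/-- The density of the quotient measure. -/
noncomputable def quotientDensity (e : ℕ → ℝ) (y : Fin 3 → ℝ) : ℝ :=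
  1 / polarDet e 1 (y 0) (y 1) (y 2)

variable (e : ℕ → ℝ)

theorem measurable_polarDensity : Measurable (polarDensity e) := by
  unfold polarDensity polarDet quarticHess
  fun_prop

theorem measurable_quotientDensity : Measurable (quotientDensity e) := by
  unfold quotientDensity polarDet quarticHess
  fun_prop

theorem measurable_polarStep : Measurable (polarStep e) := by
  refine measurable_cons_cons (by fun_prop) (measurable_cons_cons ?_ ?_)
  · unfold polarX polarNumX polarDet quarticHess
    fun_prop
  · unfold polarY polarNumY polarDet quarticHess
    fun_prop

theorem measurable_scalingQuotient : Measurable scalingQuotient :=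
  measurable_cons_cons_cons (by fun_prop) (by fun_prop) (by fun_prop)

theorem polarDensity_swap (a b : Fin 2 → ℝ) : polarDensity e ![a, b] = polarDensity e ![b, a] := by
  simp [polarDensity, polarDet_comm e (a 0)]

/-- The polar map preserves the measure `dx₀ dx₁ / |D|`. -/
theorem measurePreserving_polarStep :
    MeasurePreserving (polarStep e) (densityMeasure (polarDensity e))
      (densityMeasure (polarDensity e)) := by
  have hρ := measurable_polarDensity e
  have hφ := measurable_polarStep e
  refine measurePreserving_densityMeasure hρ hφ fun F hF => ?_
  have hp : Measurable fun z : (Fin 2 → ℝ) × (Fin 2 → ℝ) => ![z.1, z.2] :=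
    measurable_cons_cons measurable_fst measurable_snd
  have hG : Measurable fun x => ENNReal.ofReal |polarDensity e x| * F (polarStep e x) :=
    (by fun_prop : Measurable fun x => ENNReal.ofReal |polarDensity e x|).mul (hF.comp hφ)
  -- On the left x₁ becomes the outer variable, so that for each fixed x₁ the planar map x₀ ↦ x₂
  -- acts in the inner integral.
  rw [lintegral_fin_two_pair hG, lintegral_lintegral_swap
    (f := fun a b => ENNReal.ofReal |polarDensity e ![a, b]| * F (polarStep e ![a, b]))
    (hG.comp hp).aemeasurable,
    lintegral_fin_two_pair (by fun_prop)]
  refine lintegral_congr fun b => ?_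
  have h := lintegral_polarPlane e (b 0) (b 1) fun a => F ![b, a]
  simp only [polarDensity_swap e b]
  exact h

theorem scaling_apply (c : ℝˣ) (x : Fin 2 → Fin 2 → ℝ) :
    scaling c x = ![![c * x 0 0, c * x 0 1], ![(c : ℝ)⁻¹ * x 1 0, (c : ℝ)⁻¹ * x 1 1]] := by
  ext i j
  fin_cases i <;> fin_cases j <;> simp [scaling]

theorem measurable_scaling (c : ℝˣ) : Measurable (scaling c : (Fin 2 → Fin 2 → ℝ) → _) :=
  measurable_cons_cons (by fun_prop) (by fun_prop)

theorem polarDensity_scaling (c : ℝˣ) (x : Fin 2 → Fin 2 → ℝ) :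
    polarDensity e (scaling c x) = polarDensity e x := by
  simp [polarDensity, scaling_apply, polarDet_smul e _ _ _ _ (mul_inv_cancel₀ c.ne_zero)]

theorem measurePreserving_scaling (c : ℝˣ) :
    MeasurePreserving (scaling c) (densityMeasure (polarDensity e))
      (densityMeasure (polarDensity e)) := by
  have hρ := measurable_polarDensity e
  have hc := c.ne_zero
  refine measurePreserving_densityMeasure hρ (measurable_scaling c) fun F hF => ?_
  have hG : Measurable fun x => ENNReal.ofReal |polarDensity e x| * F x := by fun_prop
  have h1 : ∀ x, ENNReal.ofReal |polarDensity e x| * F (scaling c x) =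
      ENNReal.ofReal |polarDensity e (scaling c x)| * F (scaling c x) := fun x => by
    rw [polarDensity_scaling]
  simp only [h1]
  have hs := measurable_scaling c
  rw [lintegral_fin_two_fin_two (by fun_prop), lintegral_fin_two_fin_two hG]
  simp only [scaling_apply, Matrix.cons_val_zero, Matrix.cons_val_one]
  have h2 : ∀ p, ∫⁻ q, ∫⁻ u, ∫⁻ v, ENNReal.ofReal |polarDensity e
        ![![p, c * q], ![(c : ℝ)⁻¹ * u, (c : ℝ)⁻¹ * v]]| *
          F ![![p, c * q], ![(c : ℝ)⁻¹ * u, (c : ℝ)⁻¹ * v]] = _ :=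
    fun p => lintegral_fin_three_comp_mul hc (inv_ne_zero hc) (inv_ne_zero hc) fun q u v =>
      ENNReal.ofReal |polarDensity e ![![p, q], ![u, v]]| * F ![![p, q], ![u, v]]
  simp only [h2]
  rw [lintegral_comp_mul_left hc fun p => ENNReal.ofReal |((c : ℝ) * (c : ℝ)⁻¹ * (c : ℝ)⁻¹)⁻¹| *
    ∫⁻ q, ∫⁻ u, ∫⁻ v, ENNReal.ofReal |polarDensity e ![![p, q], ![u, v]]| * F ![![p, q], ![u, v]],
    lintegral_const_mul' _ _ ENNReal.ofReal_ne_top, ← mul_assoc,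
    ← ENNReal.ofReal_mul (abs_nonneg _), ← abs_mul]
  simp [hc]

/-- In the coordinates given by the invariants and the orbit coordinate, the invariant measure is
the product of the quotient measure and the Haar measure of the scaling group. -/
theorem map_scalingQuotient :
    Measure.map (fun x => (scalingQuotient x, x 0 0)) (densityMeasure (polarDensity e)) =
      (densityMeasure (quotientDensity e)).prod (densityMeasure fun t : ℝ => 1 / t) := by
  have hρ := measurable_polarDensity e
  have hρ' := measurable_quotientDensity e
  have hm : Measurable fun x : Fin 2 → Fin 2 → ℝ => (scalingQuotient x, x 0 0) :=
    measurable_scalingQuotient.prodMk (by fun_prop)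
  have hq := measurable_scalingQuotient
  refine Measure.ext_of_lintegral _ fun F hF => ?_
  rw [lintegral_map hF hm, lintegral_densityMeasure hρ
    (by fun_prop : Measurable fun x => F (scalingQuotient x, x 0 0)),
    lintegral_fin_two_fin_two (by fun_prop)]
  rw [densityMeasure, densityMeasure, prod_withDensity (by fun_prop) (by fun_prop),
    lintegral_withDensity_eq_lintegral_mul _ (by fun_prop) hF, lintegral_prod_symm _ (by fun_prop)]
  refine lintegral_congr_ae ?_
  filter_upwards [Measure.ae_ne volume (0 : ℝ)] with t ht
  rw [lintegral_fin_three (by fun_prop)]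
  -- On the slice x₀₀ = t the invariants are y = (t⁻¹ q, t u, t v). Hence dq du dv = dy/|t|, which
  -- is the source of the Haar density; the scaling by t⁻¹ normalizes x₀ to (1, y₀) without changing
  -- D.
  have h := lintegral_fin_three_comp_mul (inv_ne_zero ht) ht ht fun a b c =>
    ENNReal.ofReal |quotientDensity e ![a, b, c]| * F (![a, b, c], t)
  rw [inv_mul_cancel₀ ht, one_mul] at h
  have h1 : ∀ q u v : ℝ, polarDensity e ![![t, q], ![u, v]] =
      quotientDensity e ![t⁻¹ * q, t * u, t * v] := fun q u v => by
    have := polarDet_smul e t q u v (inv_mul_cancel₀ ht)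
    rw [inv_mul_cancel₀ ht] at this
    simp [polarDensity, quotientDensity, this]
  have h2 : ∀ q u v : ℝ, scalingQuotient ![![t, q], ![u, v]] = ![t⁻¹ * q, t * u, t * v] :=
    fun q u v => by simp [scalingQuotient, div_eq_inv_mul]
  simp only [h1, h2, Matrix.cons_val_zero]
  rw [h, ← lintegral_const_mul' _ _ ENNReal.ofReal_ne_top]
  refine lintegral_congr fun a => ?_
  rw [← lintegral_const_mul' _ _ ENNReal.ofReal_ne_top]
  refine lintegral_congr fun b => ?_
  rw [← lintegral_const_mul' _ _ ENNReal.ofReal_ne_top]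
  refine lintegral_congr fun c => ?_
  simp only [Pi.mul_apply, one_div]
  ring

end PolarStep

/-! ### The reduced map -/

section Haar

instance {E : Type*} [MeasureSpace E] [SFinite (volume : Measure E)] (ρ : E → ℝ) :
    SFinite (densityMeasure ρ) := by
  unfold densityMeasure
  infer_instance

/-- The annulus `1 ≤ |t| ≤ 2`. -/
def realAnnulus : Set ℝ := (fun t => |t|) ⁻¹' Set.Icc 1 2

theorem measurableSet_realAnnulus : MeasurableSet realAnnulus :=
  (by fun_prop : Measurable fun t : ℝ => |t|) measurableSet_Icc

/-- The Haar measure of the multiplicative group is invariant under inversion; the invariance is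
stated for an annulus. -/
theorem haar_annulus_div {c : ℝ} (hc : c ≠ 0) :
    densityMeasure (fun t : ℝ => 1 / t) {t | c / t ∈ realAnnulus} =
      densityMeasure (fun t : ℝ => 1 / t) realAnnulus := by
  have hc' : 2 / c ≠ 0 := div_ne_zero two_ne_zero hc
  have hm := measurableSet_realAnnulus
  -- The condition 1 ≤ |c/t| ≤ 2 is the same as 1 ≤ |2t/c| ≤ 2, because the product of the endpoints
  -- is 2. Inversion thus acts on the annulus like a dilation, under which dt/|t| is invariant. At t
  -- = 0 both conditions fail, as c/0 = 0.
  have h1 : {t : ℝ | c / t ∈ realAnnulus} =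
      (fun t => 2 / c * t) ⁻¹' realAnnulus := by
    ext t
    have hc0 : 0 < |c| := abs_pos.2 hc
    rcases eq_or_ne t 0 with rfl | ht
    · simp [realAnnulus]
    have ht0 : 0 < |t| := abs_pos.2 ht
    simp only [realAnnulus, Set.mem_preimage, Set.mem_Icc, Set.mem_ofPred_eq, abs_div, abs_mul, abs_two]
    rw [le_div_iff₀ ht0, div_le_iff₀ ht0, div_mul_eq_mul_div, le_div_iff₀ hc0, div_le_iff₀ hc0]
    constructor <;> rintro ⟨h, h'⟩ <;> constructor <;> linarith
  rw [h1, densityMeasure, withDensity_apply _ (measurableSet_preimage (by fun_prop) hm),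
    withDensity_apply _ hm, ← lintegral_indicator (measurableSet_preimage (by fun_prop) hm),
    ← lintegral_indicator hm]
  have h2 : ∀ t : ℝ, ((fun t => 2 / c * t) ⁻¹' realAnnulus).indicator
      (fun t => ENNReal.ofReal |1 / t|) t = ENNReal.ofReal |2 / c| *
        realAnnulus.indicator (fun t => ENNReal.ofReal |1 / t|) (2 / c * t) := by
    intro t
    by_cases ht : 2 / c * t ∈ realAnnulus
    · rw [Set.indicator_of_mem ht, Set.indicator_of_mem (by exact ht),
        ← ENNReal.ofReal_mul (abs_nonneg _), ← abs_mul]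
      congr 2
      field_simp
    · rw [Set.indicator_of_notMem ht, Set.indicator_of_notMem (by exact ht), mul_zero]
  simp only [h2]
  rw [lintegral_const_mul' _ _ ENNReal.ofReal_ne_top, lintegral_comp_mul_left hc', ← mul_assoc,
    ← ENNReal.ofReal_mul (abs_nonneg _), ← abs_mul, mul_inv_cancel₀ hc']
  simp

theorem haar_annulus_ne_zero :
    densityMeasure (fun t : ℝ => 1 / t) realAnnulus ≠ 0 := by
  intro h
  have h1 := (ae_densityMeasure_iff (ρ := fun t : ℝ => 1 / t) (by fun_prop)
    ((Measure.ae_ne volume (0 : ℝ)).mono fun t ht => by simpa using ht)).1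
    (measure_eq_zero_iff_ae_notMem.1 h)
  have h2 : volume (Set.Icc (1 : ℝ) 2) = 0 :=
    measure_mono_null (t := realAnnulus) (fun t ht => ⟨ht.1.trans (le_abs_self t),
      abs_le.2 ⟨by linarith [ht.1], ht.2⟩⟩) (measure_eq_zero_iff_ae_notMem.2 h1)
  norm_num [Real.volume_Icc] at h2

theorem haar_annulus_ne_top :
    densityMeasure (fun t : ℝ => 1 / t) realAnnulus ≠ ⊤ := by
  have hm := measurableSet_realAnnulus
  rw [densityMeasure, withDensity_apply _ hm]
  refine ne_top_of_le_ne_top (b := volume (Set.Icc (-2 : ℝ) 2)) (by simp) ?_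
  calc ∫⁻ t in realAnnulus, ENNReal.ofReal |1 / t|
      ≤ ∫⁻ t in realAnnulus, 1 := by
        refine setLIntegral_mono (by fun_prop) fun t ht => ?_
        rw [ENNReal.ofReal_le_one, abs_div, abs_one]
        exact div_le_one_of_le₀ ht.1 (abs_nonneg t)
    _ ≤ volume (Set.Icc (-2 : ℝ) 2) := by
        rw [setLIntegral_one]
        exact measure_mono fun t ht => abs_le.1 ht.2

end Haar

/-! ### The map induced by a single polar step on the quotient, and its invariant measure. -/

section Reduced

/-- The map induced by the polar map on the quotient by the scaling group. -/
noncomputable def reducedStep (e : ℕ → ℝ) (y : Fin 3 → ℝ) : Fin 3 → ℝ :=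
  ![y 2 / y 1, y 1 * polarX e 1 (y 0) (y 1) (y 2), y 1 * polarY e 1 (y 0) (y 1) (y 2)]

/-- The inverse of the reduced map. -/
noncomputable def reducedStepInv (e : ℕ → ℝ) (y : Fin 3 → ℝ) : Fin 3 → ℝ :=
  ![polarY (-e) (y 1) (y 2) 1 (y 0) / polarX (-e) (y 1) (y 2) 1 (y 0),
    polarX (-e) (y 1) (y 2) 1 (y 0), polarX (-e) (y 1) (y 2) 1 (y 0) * y 0]

variable (e : ℕ → ℝ)

/-- The polar step carries scaling orbits to scaling orbits, so the image may be computed from the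
representative with x₀ = (1, y₀), x₁ = (y₁, y₂). The new orbit coordinate of that representative is
y₁, which explains the division in the first component and the factors y₁ in the others. -/
theorem scalingQuotient_polarStep {x : Fin 2 → Fin 2 → ℝ} (hx : x 0 0 ≠ 0) :
    scalingQuotient (polarStep e x) = reducedStep e (scalingQuotient x) := by
  have h1 := polarX_smul e (x 0 0) (x 0 1) (x 1 0) (x 1 1) (inv_mul_cancel₀ hx)
  have h2 := polarY_smul e (x 0 0) (x 0 1) (x 1 0) (x 1 1) (inv_mul_cancel₀ hx)
  rw [inv_mul_cancel₀ hx, ← div_eq_inv_mul (x 0 1)] at h1 h2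
  ext i
  fin_cases i
  · simp [scalingQuotient, reducedStep, polarStep, mul_div_mul_left _ _ hx]
  · simp [scalingQuotient, reducedStep, polarStep, h1]
    field_simp
  · simp [scalingQuotient, reducedStep, polarStep, h2]
    field_simp

theorem measurable_reducedStep : Measurable (reducedStep e) := by
  refine measurable_cons_cons_cons (by fun_prop) ?_ ?_
  · unfold polarX polarNumX polarDet quarticHess
    fun_prop
  · unfold polarY polarNumY polarDet quarticHess
    fun_prop

theorem ae_polarDensity_ne_zero : ∀ᵐ x, polarDensity e x ≠ 0 :=
  ((generically_polarDet_ne_zero e (.coord₂ 0 0) (.coord₂ 0 1) (.coord₂ 1 0) (.coord₂ 1 1)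
    (x₀ := (0 : Fin 2 → Fin 2 → ℝ)) (by simp)).mono fun _ h => one_div_ne_zero h.1).ae

theorem generically_quotientDensity_ne_zero : Generically fun y => quotientDensity e y ≠ 0 :=
  (generically_polarDet_ne_zero e (.const 1) (.coord 0) (.coord 1) (.coord 2)
    (x₀ := (0 : Fin 3 → ℝ)) (by simp)).mono fun _ h => one_div_ne_zero h.1

theorem generically_coord_ne_zero {ι : Type*} (i : ι) : Generically fun x : ι → ℝ => x i ≠ 0 :=
  ⟨fun x => x i, .coord i, Function.ne_iff.2 ⟨fun _ => 1, one_ne_zero⟩, fun _ => id⟩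

theorem generically_coord₂_ne_zero {ι κ : Type*} (i : ι) (j : κ) :
    Generically fun x : ι → κ → ℝ => x i j ≠ 0 :=
  ⟨fun x => x i j, .coord₂ i j, Function.ne_iff.2 ⟨fun _ _ => 1, one_ne_zero⟩, fun _ => id⟩

/-- The disintegration of the measure is used with e = 0, where D = 1 and the measures involved are
the Lebesgue measures: the preimage of a null set s corresponds to the null cylinder over s. -/
theorem quasiMeasurePreserving_scalingQuotient :
    Measure.QuasiMeasurePreserving scalingQuotient := by
  refine ⟨measurable_scalingQuotient, Measure.AbsolutelyContinuous.mk fun s hs h0 => ?_⟩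
  have hm : Measurable fun x : Fin 2 → Fin 2 → ℝ => (scalingQuotient x, x 0 0) :=
    measurable_scalingQuotient.prodMk (by fun_prop)
  have hs' : densityMeasure (quotientDensity (0 : ℕ → ℝ)) s = 0 :=
    withDensity_absolutelyContinuous _ _ h0
  have h1 : Measure.map (fun x => (scalingQuotient x, x 0 0)) (densityMeasure (polarDensity 0))
      (s ×ˢ Set.univ) = 0 := by
    rw [map_scalingQuotient, Measure.prod_prod, hs', zero_mul]
  rw [Measure.map_apply hm (hs.prod .univ)] at h1
  rw [Measure.map_apply measurable_scalingQuotient hs]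
  have h2 := (ae_densityMeasure_iff (measurable_polarDensity 0) (ae_polarDensity_ne_zero 0)).1
    (measure_eq_zero_iff_ae_notMem.1 h1)
  exact measure_eq_zero_iff_ae_notMem.2 (h2.mono fun x hx hx' => hx ⟨hx', Set.mem_univ _⟩)

/-- In the coordinates (y, t) the polar step is (y, t) ↦ (Φ(y), y₁/t) and preserves ν ⊗ dt/|t|.
Evaluating this on A × B with B an annulus gives ν(A) l(B) = ν(Φ⁻¹A) l(B), and l(B) can be cancelled
because it is neither zero nor infinite. -/
theorem measurePreserving_reducedStep :
    MeasurePreserving (reducedStep e) (densityMeasure (quotientDensity e))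
      (densityMeasure (quotientDensity e)) := by
  refine ⟨measurable_reducedStep e, Measure.ext fun A hA => ?_⟩
  have hΦ := measurable_reducedStep e
  set ν := densityMeasure (quotientDensity e)
  set μ := densityMeasure (polarDensity e)
  set l := densityMeasure fun t : ℝ => 1 / t
  have hB := measurableSet_realAnnulus
  have hm : Measurable fun x : Fin 2 → Fin 2 → ℝ => (scalingQuotient x, x 0 0) :=
    measurable_scalingQuotient.prodMk (by fun_prop)
  have hS : MeasurableSet {z : (Fin 3 → ℝ) × ℝ | reducedStep e z.1 ∈ A ∧ z.1 1 / z.2 ∈ realAnnulus} :=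
    ((hΦ.comp measurable_fst) hA).inter
      ((by fun_prop : Measurable fun z : (Fin 3 → ℝ) × ℝ => z.1 1 / z.2) hB)
  have h1 : μ ((fun x => (scalingQuotient x, x 0 0)) ⁻¹' (A ×ˢ realAnnulus)) = ν A * l realAnnulus := by
    rw [← Measure.map_apply hm (hA.prod hB), map_scalingQuotient, Measure.prod_prod]
  have h2 : μ ((fun x => (scalingQuotient x, x 0 0)) ⁻¹' (A ×ˢ realAnnulus)) =
      μ ((fun x => (scalingQuotient x, x 0 0)) ⁻¹'
        {z | reducedStep e z.1 ∈ A ∧ z.1 1 / z.2 ∈ realAnnulus}) := by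
    rw [← (measurePreserving_polarStep e).measure_preimage (hm (hA.prod hB)).nullMeasurableSet]
    refine measure_congr ?_
    have h3 : ∀ᵐ x ∂μ, x 0 0 ≠ 0 :=
      (ae_densityMeasure_iff (measurable_polarDensity e) (ae_polarDensity_ne_zero e)).2
        (generically_coord₂_ne_zero (0 : Fin 2) (0 : Fin 2)).ae
    filter_upwards [h3] with x hx
    refine propext ?_
    change (scalingQuotient (polarStep e x) ∈ A ∧ x 1 0 ∈ realAnnulus) ↔
      (reducedStep e (scalingQuotient x) ∈ A ∧ x 0 0 * x 1 0 / x 0 0 ∈ realAnnulus)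
    rw [scalingQuotient_polarStep e hx, mul_div_cancel_left₀ _ hx]
  -- The fibre over y is empty unless Φ(y) ∈ A, and then it is {t | y₁/t ∈ B}, which has the measure
  -- of B by invariance under inversion.
  have h4 : (ν.prod l) {z | reducedStep e z.1 ∈ A ∧ z.1 1 / z.2 ∈ realAnnulus} =
      ν (reducedStep e ⁻¹' A) * l realAnnulus := by
    rw [Measure.prod_apply hS, mul_comm, ← lintegral_indicator_const (hΦ hA)]
    refine lintegral_congr_ae ?_
    have h5 : ∀ᵐ y ∂ν, y 1 ≠ 0 :=
      (ae_densityMeasure_iff (measurable_quotientDensity e)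
        (generically_quotientDensity_ne_zero e).ae).2
        (generically_coord_ne_zero (1 : Fin 3)).ae
    filter_upwards [h5] with y hy
    by_cases hyA : reducedStep e y ∈ A
    · rw [Set.indicator_of_mem (by exact hyA), ← haar_annulus_div hy]
      congr 1
      ext t
      simp [hyA]
    · rw [Set.indicator_of_notMem (by exact hyA)]
      convert measure_empty (μ := l)
      ext t
      simp [hyA]
  rw [Measure.map_apply hΦ hA]
  rw [h2, ← Measure.map_apply hm hS, map_scalingQuotient, h4] at h1
  exact (ENNReal.mul_left_inj haar_annulus_ne_zero haar_annulus_ne_top).1 h1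

end Reduced

/-! ### Derivatives of rational functions -/

section Derivative

variable {E : Type*} [NormedAddCommGroup E] [NormedSpace ℝ E] [FiniteDimensional ℝ E]

theorem IsPolynomialFun.differentiable_and_fderiv {p : E → ℝ} (hp : IsPolynomialFun p) :
    Differentiable ℝ p ∧ ∀ v, IsPolynomialFun fun x => fderiv ℝ p x v := by
  refine Algebra.adjoin_induction (p := fun p _ => Differentiable ℝ p ∧
    ∀ v, IsPolynomialFun fun x => fderiv ℝ p x v) ?_ ?_ ?_ ?_ hp
  · rintro _ ⟨l, rfl⟩
    have h : ∀ x, HasFDerivAt (fun x => l x) l.toContinuousLinearMap x :=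
      fun x => l.toContinuousLinearMap.hasFDerivAt
    refine ⟨fun x => (h x).differentiableAt, fun v => ?_⟩
    simp only [(h _).fderiv]
    exact .const _
  · refine fun r => ⟨differentiable_const r, fun v => ?_⟩
    have h : (fun x : E => fderiv ℝ (algebraMap ℝ (E → ℝ) r) x v) = fun _ => 0 :=
      funext fun x => by
        have : HasFDerivAt (algebraMap ℝ (E → ℝ) r) (0 : E →L[ℝ] ℝ) x :=
          hasFDerivAt_const (𝕜 := ℝ) (E := E) r x
        rw [this.fderiv, _root_.zero_apply]
    rw [h]
    exact .const 0
  · rintro p q - - ⟨h1, h2⟩ ⟨h3, h4⟩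
    refine ⟨h1.add h3, fun v => ?_⟩
    simp only [fun x => fderiv_add (h1 x) (h3 x)]
    exact (h2 v).add (h4 v)
  · rintro p q hp hq ⟨h1, h2⟩ ⟨h3, h4⟩
    refine ⟨h1.mul h3, fun v => ?_⟩
    simp only [fun x => fderiv_mul (h1 x) (h3 x)]
    exact (IsPolynomialFun.mul hp (h4 v)).add (IsPolynomialFun.mul hq (h2 v))

theorem IsRationalFun.fderiv_apply {f : E → ℝ} (hf : IsRationalFun f) (v : E) :
    IsRationalFun fun x => fderiv ℝ f x v := by
  obtain ⟨p, q, hp, hq, hq0, H⟩ := hf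
  obtain ⟨hp1, hp2⟩ := hp.differentiable_and_fderiv
  obtain ⟨hq1, hq2⟩ := hq.differentiable_and_fderiv
  refine ⟨_, _, ((hp2 v).mul hq).sub (hp.mul (hq2 v)), hq.mul hq,
    hq.mul_ne_zero hq hq0 hq0, fun x hx => ?_⟩
  have hx := left_ne_zero_of_mul hx
  have h1 : f =ᶠ[nhds x] fun x => p x * (q x)⁻¹ :=
    (hq1.continuous.continuousAt.eventually_ne hx).mono fun y hy => by
      rw [H y hy, div_eq_mul_inv]
  have h2 := (hp1 x).hasFDerivAt.mul
    ((hasDerivAt_inv hx).comp_hasFDerivAt x (hq1 x).hasFDerivAt)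
  simp only [h1.fderiv_eq]
  have h3 := h2.fderiv
  change fderiv ℝ (fun x => p x * (q x)⁻¹) x = _ at h3
  rw [h3]
  simp
  field_simp
  ring

end Derivative

/-! ### Rationality of the maps and densities. -/

section Rationality

variable {E : Type*} [AddCommGroup E] [Module ℝ E] {p q u v : E → ℝ} (e : ℕ → ℝ)

theorem isRationalFun_polarX (hp : IsPolynomialFun p) (hq : IsPolynomialFun q)
    (hu : IsPolynomialFun u) (hv : IsPolynomialFun v) :
    IsRationalFun fun x => polarX e (p x) (q x) (u x) (v x) :=
  (IsRationalFun.of_polynomial (isPolynomialFun_polarNumX e hp hq hu hv)).div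
    (.of_polynomial (isPolynomialFun_polarDet e hp hq hu hv))

theorem isRationalFun_polarY (hp : IsPolynomialFun p) (hq : IsPolynomialFun q)
    (hu : IsPolynomialFun u) (hv : IsPolynomialFun v) :
    IsRationalFun fun x => polarY e (p x) (q x) (u x) (v x) :=
  (IsRationalFun.of_polynomial (isPolynomialFun_polarNumY e hp hq hu hv)).div
    (.of_polynomial (isPolynomialFun_polarDet e hp hq hu hv))

theorem isRationalMap_vec₂ {F : Type*} [AddCommGroup F] [Module ℝ F] {f g : E → F}
    (hf : IsRationalMap f) (hg : IsRationalMap g) : IsRationalMap fun x => ![f x, g x] := by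
  refine IsRationalMap.pi fun i => ?_
  fin_cases i
  · exact hf
  · exact hg

theorem isRationalMap_vec₃ {f g h : E → ℝ} (hf : IsRationalFun f) (hg : IsRationalFun g)
    (hh : IsRationalFun h) : IsRationalMap fun x => ![f x, g x, h x] := by
  refine IsRationalMap.pi fun i => ?_
  fin_cases i
  · exact .of_real hf
  · exact .of_real hg
  · exact .of_real hh

theorem isRationalMap_reducedStep : IsRationalMap (reducedStep e) :=
  isRationalMap_vec₃
    ((IsRationalFun.of_polynomial (.coord 2)).div (.of_polynomial (.coord 1)))
    ((IsRationalFun.of_polynomial (.coord 1)).mul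
      (isRationalFun_polarX e (.const 1) (.coord 0) (.coord 1) (.coord 2)))
    ((IsRationalFun.of_polynomial (.coord 1)).mul
      (isRationalFun_polarY e (.const 1) (.coord 0) (.coord 1) (.coord 2)))

theorem isRationalMap_reducedStepInv : IsRationalMap (reducedStepInv e) :=
  have hX := isRationalFun_polarX (E := Fin 3 → ℝ) (-e) (.coord 1) (.coord 2) (.const 1) (.coord 0)
  have hY := isRationalFun_polarY (E := Fin 3 → ℝ) (-e) (.coord 1) (.coord 2) (.const 1) (.coord 0)
  isRationalMap_vec₃ (hY.div hX) hX (hX.mul (.of_polynomial (.coord 0)))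

theorem isRationalMap_scalingQuotient : IsRationalMap scalingQuotient :=
  isRationalMap_vec₃
    ((IsRationalFun.of_polynomial (.coord₂ 0 1)).div (.of_polynomial (.coord₂ 0 0)))
    (.of_polynomial ((IsPolynomialFun.coord₂ 0 0).mul (.coord₂ 1 0)))
    (.of_polynomial ((IsPolynomialFun.coord₂ 0 0).mul (.coord₂ 1 1)))

theorem isRationalMap_scalingSection : IsRationalMap scalingSection :=
  isRationalMap_vec₂
    (isRationalMap_vec₂ (.of_real (.of_polynomial .snd))
      (.of_real (.of_polynomial (IsPolynomialFun.snd.mul (.fst_coord 0)))))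
    (isRationalMap_vec₂
      (.of_real ((IsRationalFun.of_polynomial (.fst_coord 1)).div (.of_polynomial .snd)))
      (.of_real ((IsRationalFun.of_polynomial (.fst_coord 2)).div (.of_polynomial .snd))))

theorem isRationalMap_polarStep : IsRationalMap (polarStep e) :=
  isRationalMap_vec₂ (.pi fun i => .of_real (.of_polynomial (.coord₂ 1 i)))
    (isRationalMap_vec₂
      (.of_real (isRationalFun_polarX e (.coord₂ 0 0) (.coord₂ 0 1) (.coord₂ 1 0) (.coord₂ 1 1)))
      (.of_real (isRationalFun_polarY e (.coord₂ 0 0) (.coord₂ 0 1) (.coord₂ 1 0) (.coord₂ 1 1))))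

theorem isRationalFun_polarDensity : IsRationalFun (polarDensity e) :=
  (IsRationalFun.const 1).div (.of_polynomial
    (isPolynomialFun_polarDet e (.coord₂ 0 0) (.coord₂ 0 1) (.coord₂ 1 0) (.coord₂ 1 1)))

theorem isRationalFun_quotientDensity : IsRationalFun (quotientDensity e) :=
  (IsRationalFun.const 1).div (.of_polynomial
    (isPolynomialFun_polarDet e (.const 1) (.coord 0) (.coord 1) (.coord 2)))

end Rationality

/-! ### Inverses of the polar map and of the reduced map. -/

section Birational

variable (e : ℕ → ℝ)

/-- The inverse of the polar map: reverse the order of the two points and the time. -/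
noncomputable def polarStepInv (x : Fin 2 → Fin 2 → ℝ) : Fin 2 → Fin 2 → ℝ :=
  ![polarStep (-e) ![x 1, x 0] 1, x 0]

theorem isBirational_polarStep : IsBirational (polarStep e) := by
  refine ⟨isRationalMap_polarStep e, polarStepInv e, ?_, ?_, ?_⟩
  · exact isRationalMap_vec₂
      (isRationalMap_vec₂
        (.of_real (isRationalFun_polarX (-e) (.coord₂ 1 0) (.coord₂ 1 1) (.coord₂ 0 0)
          (.coord₂ 0 1)))
        (.of_real (isRationalFun_polarY (-e) (.coord₂ 1 0) (.coord₂ 1 1) (.coord₂ 0 0)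
          (.coord₂ 0 1))))
      (.pi fun i => .of_real (.of_polynomial (.coord₂ 0 i)))
  · refine (generically_polarDet_ne_zero e (.coord₂ 0 0) (.coord₂ 0 1) (.coord₂ 1 0) (.coord₂ 1 1)
      (x₀ := (0 : Fin 2 → Fin 2 → ℝ)) (by simp)).mono fun x hx => ?_
    obtain ⟨h1, h2⟩ := polar_neg_polar hx.1 rfl rfl hx.2
    ext i j
    fin_cases i <;> fin_cases j <;> simp [polarStepInv, polarStep, h1, h2]
  · refine (generically_polarDet_ne_zero (-e) (.coord₂ 1 0) (.coord₂ 1 1) (.coord₂ 0 0)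
      (.coord₂ 0 1) (x₀ := (0 : Fin 2 → Fin 2 → ℝ)) (by simp)).mono fun x hx => ?_
    obtain ⟨h1, h2⟩ := polar_neg_polar hx.1 rfl rfl hx.2
    rw [neg_neg] at h1 h2
    ext i j
    fin_cases i <;> fin_cases j <;> simp [polarStepInv, polarStep, h1, h2]

/-- The points where the reduced map and its inverse are regular. -/
def ReducedRegular (y : Fin 3 → ℝ) : Prop :=
  y 1 ≠ 0 ∧ polarDet e 1 (y 0) (y 1) (y 2) ≠ 0 ∧
    polarDet e (y 1) (y 2) (polarX e 1 (y 0) (y 1) (y 2)) (polarY e 1 (y 0) (y 1) (y 2)) ≠ 0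

theorem generically_reducedRegular : Generically (ReducedRegular e) :=
  (generically_coord_ne_zero 1).and
    (generically_polarDet_ne_zero e (.const 1) (.coord 0) (.coord 1) (.coord 2)
      (x₀ := (0 : Fin 3 → ℝ)) (by simp))

variable {e}

theorem polarX_reduced {u : ℝ} (hu : u ≠ 0) (v P Q : ℝ) :
    polarX e 1 (v / u) (u * P) (u * Q) = u⁻¹ * polarX e u v P Q := by
  rw [← polarX_smul e u v P Q (inv_mul_cancel₀ hu), inv_mul_cancel₀ hu, div_eq_inv_mul]

theorem polarY_reduced {u : ℝ} (hu : u ≠ 0) (v P Q : ℝ) :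
    polarY e 1 (v / u) (u * P) (u * Q) = u⁻¹ * polarY e u v P Q := by
  rw [← polarY_smul e u v P Q (inv_mul_cancel₀ hu), inv_mul_cancel₀ hu, div_eq_inv_mul]

theorem polarDet_reduced {u : ℝ} (hu : u ≠ 0) (v P Q : ℝ) :
    polarDet e 1 (v / u) (u * P) (u * Q) = polarDet e u v P Q := by
  rw [← polarDet_smul e u v P Q (inv_mul_cancel₀ hu), inv_mul_cancel₀ hu, div_eq_inv_mul]

theorem reducedStepInv_reducedStep {y : Fin 3 → ℝ} (hy : ReducedRegular e y) :
    reducedStepInv e (reducedStep e y) = y := by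
  obtain ⟨hu, hD, hD'⟩ := hy
  obtain ⟨h1, h2⟩ := polar_neg_polar hD rfl rfl hD'
  have h3 : ∀ P Q, polarX (-e) (y 1 * P) (y 1 * Q) 1 (y 2 / y 1) =
      y 1 * polarX (-e) P Q (y 1) (y 2) := fun P Q => by
    rw [← polarX_smul (-e) P Q (y 1) (y 2) (mul_inv_cancel₀ hu), inv_mul_cancel₀ hu,
      div_eq_inv_mul]
  have h4 : ∀ P Q, polarY (-e) (y 1 * P) (y 1 * Q) 1 (y 2 / y 1) =
      y 1 * polarY (-e) P Q (y 1) (y 2) := fun P Q => by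
    rw [← polarY_smul (-e) P Q (y 1) (y 2) (mul_inv_cancel₀ hu), inv_mul_cancel₀ hu,
      div_eq_inv_mul]
  ext i
  fin_cases i
  · simp [reducedStepInv, reducedStep, h3, h4, h1, h2, hu]
  · simp [reducedStepInv, reducedStep, h3, h1]
  · simp [reducedStepInv, reducedStep, h3, h1]
    field_simp

theorem reducedStep_reducedStepInv {y : Fin 3 → ℝ}
    (hu : polarX (-e) (y 1) (y 2) 1 (y 0) ≠ 0) (hD : polarDet (-e) (y 1) (y 2) 1 (y 0) ≠ 0)
    (hD' : polarDet (-e) 1 (y 0) (polarX (-e) (y 1) (y 2) 1 (y 0))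
      (polarY (-e) (y 1) (y 2) 1 (y 0)) ≠ 0) :
    reducedStep e (reducedStepInv e y) = y := by
  obtain ⟨h1, h2⟩ := polar_neg_polar hD rfl rfl hD'
  rw [neg_neg] at h1 h2
  set P := polarX (-e) (y 1) (y 2) 1 (y 0)
  set Q := polarY (-e) (y 1) (y 2) 1 (y 0)
  have h3 : polarX e 1 (Q / P) P (P * y 0) = P⁻¹ * polarX e P Q 1 (y 0) := by
    simpa using polarX_reduced hu Q 1 (y 0)
  have h4 : polarY e 1 (Q / P) P (P * y 0) = P⁻¹ * polarY e P Q 1 (y 0) := by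
    simpa using polarY_reduced hu Q 1 (y 0)
  ext i
  fin_cases i
  · simp [reducedStepInv, reducedStep, P, hu]
  · simpa [reducedStepInv, reducedStep, P, Q, h3, h1] using mul_inv_cancel_left₀ hu (y 1)
  · simpa [reducedStepInv, reducedStep, P, Q, h4, h2] using mul_inv_cancel_left₀ hu (y 2)

end Birational

/-! ### Integrals and invariant vector field of the reduced map -/

section Integrals

/-- The symplectic area of `x₀` and `x₁` on the quotient. -/
def reducedArea (y : Fin 3 → ℝ) : ℝ := y 2 - y 0 * y 1

/-- The symplectic area of `x₁` and `x₂` on the quotient. -/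
noncomputable def reducedNextArea (e : ℕ → ℝ) (y : Fin 3 → ℝ) : ℝ :=
  y 1 * polarY e 1 (y 0) (y 1) (y 2) - y 2 * polarX e 1 (y 0) (y 1) (y 2)

/-- The cross product. -/
def cross (a b : Fin 3 → ℝ) : Fin 3 → ℝ :=
  ![a 1 * b 2 - a 2 * b 1, a 2 * b 0 - a 0 * b 2, a 0 * b 1 - a 1 * b 0]

/-- The gradient. -/
noncomputable def partials {n : ℕ} (f : (Fin n → ℝ) → ℝ) (y : Fin n → ℝ) : Fin n → ℝ :=
  fun i => fderiv ℝ f y (Pi.single i 1)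

/-- The vector field `D ∇J₁ × ∇J₂` on the quotient. -/
noncomputable def reducedField (e : ℕ → ℝ) (y : Fin 3 → ℝ) : Fin 3 → ℝ :=
  polarDet e 1 (y 0) (y 1) (y 2) • cross (partials reducedArea y) (partials (reducedNextArea e) y)

theorem HasPartialsAt.partials_eq {n : ℕ} {f : (Fin n → ℝ) → ℝ} {g y : Fin n → ℝ}
    (h : HasPartialsAt f g y) : partials f y = g :=
  funext fun i => by simp [partials, h.fderiv_apply]

theorem HasFDerivAt.hasPartialsAt {n : ℕ} {f : (Fin n → ℝ) → ℝ} {y : Fin n → ℝ}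
    {L : (Fin n → ℝ) →L[ℝ] ℝ} (h : HasFDerivAt f L y) : HasPartialsAt f (partials f y) y := by
  refine ⟨L, h, fun v => ?_⟩
  conv_lhs => rw [pi_eq_sum_univ' v]
  simp [partials, h.fderiv, dotProduct, mul_comm]

/-- The identity (Aᵀa) × (Aᵀb) = adj(A)(a × b), multiplied by A. It describes how the cross product
of two gradients is transported by a map with Jacobian matrix A. -/
theorem cross_vecMul (A : Matrix (Fin 3) (Fin 3) ℝ) (a b : Fin 3 → ℝ) :
    A.mulVec (cross (Matrix.vecMul a A) (Matrix.vecMul b A)) = A.det • cross a b := by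
  ext i
  fin_cases i <;>
    simp [cross, Matrix.mulVec, Matrix.vecMul, dotProduct, Fin.sum_univ_three,
      Matrix.det_fin_three] <;> ring

theorem HasPartialsAt.vec₃ {n : ℕ} {f₀ f₁ f₂ : (Fin n → ℝ) → ℝ} {g₀ g₁ g₂ y : Fin n → ℝ}
    (h₀ : HasPartialsAt f₀ g₀ y) (h₁ : HasPartialsAt f₁ g₁ y) (h₂ : HasPartialsAt f₂ g₂ y) :
    HasFDerivAt (fun x => ![f₀ x, f₁ x, f₂ x])
      (LinearMap.toContinuousLinearMap (Matrix.toLin' (Matrix.of ![g₀, g₁, g₂]))) y := by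
  refine HasPartialsAt.pi fun i => ?_
  fin_cases i
  · exact h₀
  · exact h₁
  · exact h₂

/-- Cramer's rule for the Jacobian determinant of the reduced map. -/
theorem reduced_jacobian {a u v P Q P₀ P₁ P₂ Q₀ Q₁ Q₂ b₀ b₁ b₂ c₀ c₁ c₂ d₀ d₁ d₂ : ℝ}
    (hP₀ : (1 + b₁) * P₀ + b₂ * Q₀ = -c₂) (hQ₀ : (1 - b₁) * Q₀ - b₀ * P₀ = 1 + c₁)
    (hP₁ : (1 + b₁) * P₁ + b₂ * Q₁ = -d₁) (hQ₁ : (1 - b₁) * Q₁ - b₀ * P₁ = d₀)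
    (hP₂ : (1 + b₁) * P₂ + b₂ * Q₂ = -d₂) (hQ₂ : (1 - b₁) * Q₂ - b₀ * P₂ = d₁)
    (hP : 1 - c₁ - c₂ * a = P) (hQ : a + c₀ + c₁ * a = Q)
    (h₁ : b₁ * P + b₂ * Q = d₁ * u + d₂ * v) (h₀ : b₀ * P + b₁ * Q = d₀ * u + d₁ * v) :
    (1 + b₀ * b₂ - b₁ ^ 2) * (P₀ * (u * Q₁ + v * Q₂ + Q) - Q₀ * (u * P₁ + v * P₂ + P)) =
      -(1 + c₀ * c₂ - c₁ ^ 2) := by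
  -- With M = I - A(x₀, x₁), the vector (u ∂ᵤ + v ∂ᵥ + 1) x₂ is mapped by M to x₂: M x₂ = x₀, the
  -- derivative contributes A(x₀, x₂) x₁, and this equals A(x₀, x₁) x₂ by symmetry.
  have hE : (1 + b₁) * (u * P₁ + v * P₂ + P) + b₂ * (u * Q₁ + v * Q₂ + Q) = P := by
    linear_combination u * hP₁ + v * hP₂ + h₁
  have hF : (1 - b₁) * (u * Q₁ + v * Q₂ + Q) - b₀ * (u * P₁ + v * P₂ + P) = Q := by
    linear_combination u * hQ₁ + v * hQ₂ - h₀
  -- The determinant of M times that of a pair of vectors is the determinant of their images. With N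
  -- = I + A(x₁, x₂) these images are N(0, 1) and x₂ = N(1, a), whose determinant is -det N; this is
  -- the origin of the minus sign.
  calc _ = ((1 + b₁) * P₀ + b₂ * Q₀) *
          ((1 - b₁) * (u * Q₁ + v * Q₂ + Q) - b₀ * (u * P₁ + v * P₂ + P)) -
        ((1 + b₁) * (u * P₁ + v * P₂ + P) + b₂ * (u * Q₁ + v * Q₂ + Q)) *
          ((1 - b₁) * Q₀ - b₀ * P₀) := by ring
    _ = _ := by
      rw [hP₀, hQ₀, hE, hF, ← hP, ← hQ]
      ring

variable (e : ℕ → ℝ)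

theorem hasPartialsAt_reducedArea (y : Fin 3 → ℝ) :
    HasPartialsAt reducedArea ![-y 1, -y 0, 1] y := by
  refine ((HasPartialsAt.coord 2).sub ((HasPartialsAt.coord 0).mul (.coord 1))).congr_partials
    fun i => ?_
  fin_cases i <;> simp

theorem differentiableAt_reducedNextArea {y : Fin 3 → ℝ}
    (hD : polarDet e 1 (y 0) (y 1) (y 2) ≠ 0) : DifferentiableAt ℝ (reducedNextArea e) y := by
  obtain ⟨P', Q', hP, hQ, -⟩ := exists_hasPartialsAt_polar (HasPartialsAt.const (x := y) 1)
    (.coord 0) (.coord 1) (.coord 2) e hD (fun _ => rfl) rfl rfl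
  exact (((HasPartialsAt.coord 1).mul hQ).sub ((HasPartialsAt.coord 2).mul hP)).differentiableAt

theorem isRationalFun_reducedArea : IsRationalFun reducedArea :=
  .of_polynomial ((IsPolynomialFun.coord 2).sub ((IsPolynomialFun.coord 0).mul (.coord 1)))

theorem isRationalFun_reducedNextArea : IsRationalFun (reducedNextArea e) :=
  ((IsRationalFun.of_polynomial (.coord 1)).mul
      (isRationalFun_polarY e (.const 1) (.coord 0) (.coord 1) (.coord 2))).sub
    ((IsRationalFun.of_polynomial (.coord 2)).mul
      (isRationalFun_polarX e (.const 1) (.coord 0) (.coord 1) (.coord 2)))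

theorem isRationalMap_reducedField : IsRationalMap (reducedField e) := by
  have h1 : ∀ i, IsRationalFun fun y => partials reducedArea y i :=
    fun i => isRationalFun_reducedArea.fderiv_apply _
  have h2 : ∀ i, IsRationalFun fun y => partials (reducedNextArea e) y i :=
    fun i => (isRationalFun_reducedNextArea e).fderiv_apply _
  have hD : IsRationalFun fun y : Fin 3 → ℝ => polarDet e 1 (y 0) (y 1) (y 2) :=
    .of_polynomial (isPolynomialFun_polarDet e (.const 1) (.coord 0) (.coord 1) (.coord 2))
  refine .pi fun i => .of_real (hD.mul ?_)
  fin_cases i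
  · exact ((h1 1).mul (h2 2)).sub ((h1 2).mul (h2 1))
  · exact ((h1 2).mul (h2 0)).sub ((h1 0).mul (h2 2))
  · exact ((h1 0).mul (h2 1)).sub ((h1 1).mul (h2 0))

variable {e}

theorem reducedArea_reducedStep {y : Fin 3 → ℝ} (hy : y 1 ≠ 0) :
    reducedArea (reducedStep e y) = reducedNextArea e y := by
  simp only [reducedArea, reducedStep, reducedNextArea, Matrix.cons_val]
  field_simp

/-- This is the period two of the symplectic area, ω(x₂, x₃) = ω(x₀, x₁), read on the quotient.
Together with `reducedArea_reducedStep` it shows that one step exchanges the two integrals. -/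
theorem reducedNextArea_reducedStep {y : Fin 3 → ℝ} (hy : ReducedRegular e y) :
    reducedNextArea e (reducedStep e y) = reducedArea y := by
  obtain ⟨hu, hD, hD'⟩ := hy
  have h := polar_area hD rfl rfl hD'
  simp only [reducedArea, reducedStep, reducedNextArea, Matrix.cons_val, polarX_reduced hu,
    polarY_reduced hu]
  rw [one_mul] at h
  rw [← h]
  field_simp

theorem eventually_reducedRegular {y : Fin 3 → ℝ} (hy : ReducedRegular e y) :
    ∀ᶠ z in nhds y, ReducedRegular e z := by
  obtain ⟨hu, hD, hD'⟩ := hy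
  obtain ⟨P', Q', hP, hQ, -⟩ := exists_hasPartialsAt_polar (HasPartialsAt.const (x := y) 1)
    (.coord 0) (.coord 1) (.coord 2) e hD (fun _ => rfl) rfl rfl
  have hP := hP.differentiableAt.continuousAt
  have hQ := hQ.differentiableAt.continuousAt
  have h1 : Continuous fun z : Fin 3 → ℝ => z 1 := by fun_prop
  have h2 : Continuous fun z : Fin 3 → ℝ => polarDet e 1 (z 0) (z 1) (z 2) := by
    unfold polarDet quarticHess
    fun_prop
  have h3 : ContinuousAt (fun z : Fin 3 → ℝ => polarDet e (z 1) (z 2)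
      (polarX e 1 (z 0) (z 1) (z 2)) (polarY e 1 (z 0) (z 1) (z 2))) y :=
    (continuous_polarDet e).continuousAt.comp (f := fun z : Fin 3 → ℝ => (z 1, z 2,
      polarX e 1 (z 0) (z 1) (z 2), polarY e 1 (z 0) (z 1) (z 2)))
      (h1.continuousAt.prodMk ((continuous_apply 2).continuousAt.prodMk (hP.prodMk hQ)))
  exact (h1.continuousAt.eventually_ne hu).and ((h2.continuousAt.eventually_ne hD).and (h3.eventually_ne hD'))

/-- The reduced map multiplies the invariant volume form by `-1`. -/
theorem exists_hasFDerivAt_reducedStep {y : Fin 3 → ℝ} (hy : ReducedRegular e y) :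
    ∃ A : Matrix (Fin 3) (Fin 3) ℝ,
      HasFDerivAt (reducedStep e) (LinearMap.toContinuousLinearMap (Matrix.toLin' A)) y ∧
      polarDet e 1 (y 0) (y 1) (y 2) * A.det =
        -polarDet e (y 1) (y 2) (polarX e 1 (y 0) (y 1) (y 2))
          (polarY e 1 (y 0) (y 1) (y 2)) := by
  obtain ⟨hu, hD, hD'⟩ := hy
  obtain ⟨P', Q', hP, hQ, hr⟩ := exists_hasPartialsAt_polar (HasPartialsAt.const (x := y) 1)
    (.coord 0) (.coord 1) (.coord 2) e hD (fun _ => rfl) rfl rfl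
  have h0 := (HasPartialsAt.coord (x := y) 2).div (.coord 1) hu
  have h1 := (HasPartialsAt.coord (x := y) 1).mul hP
  have h2 := (HasPartialsAt.coord (x := y) 1).mul hQ
  refine ⟨_, h0.vec₃ h1 h2, ?_⟩
  obtain ⟨s1, s2⟩ := polar_system' hD rfl rfl
  obtain ⟨t1, t2⟩ := polar_symm e 1 (y 0) (y 1) (y 2) (polarX e 1 (y 0) (y 1) (y 2))
    (polarY e 1 (y 0) (y 1) (y 2))
  have t3 : ∀ k, quarticHess e k (y 1) (y 2) (polarX e 1 (y 0) (y 1) (y 2))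
      (polarY e 1 (y 0) (y 1) (y 2)) * 1 + quarticHess e (k + 1) (y 1) (y 2)
      (polarX e 1 (y 0) (y 1) (y 2)) (polarY e 1 (y 0) (y 1) (y 2)) * y 0 =
      quarticHess e k 1 (y 0) (polarX e 1 (y 0) (y 1) (y 2)) (polarY e 1 (y 0) (y 1) (y 2)) *
        y 1 + quarticHess e (k + 1) 1 (y 0) (polarX e 1 (y 0) (y 1) (y 2))
        (polarY e 1 (y 0) (y 1) (y 2)) * y 2 := fun k => by
    unfold quarticHess
    ring
  obtain ⟨a0, b0⟩ := hr 0
  obtain ⟨a1, b1⟩ := hr 1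
  obtain ⟨a2, b2⟩ := hr 2
  simp at a0 a1 a2 b0 b1 b2
  rw [mul_one] at s1 s2
  have key := reduced_jacobian a0 b0 a1 b1 a2 b2 s1 s2 (t1.trans (t3 1)) (t2.trans (t3 0))
  rw [Matrix.det_fin_three, polarDet, polarDet, ← key]
  congr 1
  simp
  field_simp
  ring

/-- The reduced map preserves the vector field `D ∇J₁ × ∇J₂`. -/
theorem fderiv_reducedStep_reducedField {y : Fin 3 → ℝ} (hy : ReducedRegular e y)
    (hy' : ReducedRegular e (reducedStep e y)) :
    fderiv ℝ (reducedStep e) y (reducedField e y) = reducedField e (reducedStep e y) := by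
  obtain ⟨A, hA, hdet⟩ := exists_hasFDerivAt_reducedStep hy
  -- Gradients pull back by the Jacobian matrix. The identity between f ∘ Φ and g is needed on a
  -- neighbourhood, and regularity is an open condition.
  have chain : ∀ {f g : (Fin 3 → ℝ) → ℝ}, DifferentiableAt ℝ f (reducedStep e y) →
      (∀ z, ReducedRegular e z → f (reducedStep e z) = g z) →
      partials g y = Matrix.vecMul (partials f (reducedStep e y)) A := by
    intro f g hf hfg
    have h1 : g =ᶠ[nhds y] fun z => f (reducedStep e z) :=
      (eventually_reducedRegular hy).mono fun z hz => (hfg z hz).symm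
    have h2 := hf.hasFDerivAt.comp y hA
    obtain ⟨L, hL, hL'⟩ := hf.hasFDerivAt.hasPartialsAt
    ext i
    rw [partials, h1.fderiv_eq]
    have h3 := h2.fderiv
    change fderiv ℝ (fun z => f (reducedStep e z)) y = _ at h3
    rw [h3, ← hL.unique hf.hasFDerivAt]
    simp only [hL', Matrix.vecMul, ContinuousLinearMap.comp_apply,
      LinearMap.coe_toContinuousLinearMap', Matrix.toLin'_apply, Matrix.mulVec_single_one]
    rfl
  have h1 := chain (hasPartialsAt_reducedArea _).differentiableAt
    fun z hz => reducedArea_reducedStep hz.1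
  have h2 := chain (differentiableAt_reducedNextArea e hy'.2.1)
    fun z hz => reducedNextArea_reducedStep hz
  have h3 := cross_vecMul A (partials (reducedNextArea e) (reducedStep e y))
    (partials reducedArea (reducedStep e y))
  have h4 : polarDet e 1 (reducedStep e y 0) (reducedStep e y 1) (reducedStep e y 2) =
      -(polarDet e 1 (y 0) (y 1) (y 2) * A.det) := by
    rw [hdet, neg_neg]
    exact polarDet_reduced hy.1 _ _ _
  -- Exchanging the integrals reverses the cross product, and this sign cancels the one in the
  -- Jacobian determinant.
  rw [hA.fderiv, reducedField, reducedField, h4, h1, h2]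
  simp only [LinearMap.coe_toContinuousLinearMap', Matrix.toLin'_apply, Matrix.mulVec_smul, h3]
  ext i
  fin_cases i <;> simp [cross] <;> ring

/-- The vector field is tangent to the level curves of the integrals. -/
theorem fderiv_reducedField {y : Fin 3 → ℝ} (hD : polarDet e 1 (y 0) (y 1) (y 2) ≠ 0) :
    fderiv ℝ reducedArea y (reducedField e y) = 0 ∧
      fderiv ℝ (reducedNextArea e) y (reducedField e y) = 0 := by
  rw [(hasPartialsAt_reducedArea y).differentiableAt.hasFDerivAt.hasPartialsAt.fderiv_apply,
    (differentiableAt_reducedNextArea e hD).hasFDerivAt.hasPartialsAt.fderiv_apply]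
  constructor <;> (simp [reducedField, cross, dotProduct, Fin.sum_univ_three]; ring)

/-- The integrals are independent where the vector field does not vanish. -/
theorem linearIndependent_fderiv_of_reducedField {y : Fin 3 → ℝ} (hy : reducedField e y ≠ 0) :
    LinearIndependent ℝ ![fderiv ℝ reducedArea y, fderiv ℝ (reducedNextArea e) y] := by
  rw [LinearIndependent.pair_iff]
  intro s t hst
  have h1 : ∀ i, s * partials reducedArea y i + t * partials (reducedNextArea e) y i = 0 :=
    fun i => by simpa [partials] using DFunLike.congr_fun hst (Pi.single i 1)
  by_contra hne
  refine hy ?_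
  have h2 : s = 0 → t ≠ 0 := fun hs ht => hne ⟨hs, ht⟩
  have h3 : cross (partials reducedArea y) (partials (reducedNextArea e) y) = 0 := by
    by_cases hs : s = 0
    · have ht := h2 hs
      have h4 : ∀ i, partials (reducedNextArea e) y i = 0 := fun i => by
        simpa [hs, ht] using h1 i
      ext i
      fin_cases i <;> simp [cross, h4]
    · ext i
      fin_cases i <;> simp only [cross, Fin.zero_eta, Fin.mk_one,
        Fin.reduceFinMk, Matrix.cons_val, Pi.zero_apply] <;>
        apply mul_left_cancel₀ hs
      · linear_combination partials (reducedNextArea e) y 2 * h1 1 -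
          partials (reducedNextArea e) y 1 * h1 2
      · linear_combination partials (reducedNextArea e) y 0 * h1 2 -
          partials (reducedNextArea e) y 2 * h1 0
      · linear_combination partials (reducedNextArea e) y 1 * h1 0 -
          partials (reducedNextArea e) y 0 * h1 1
  rw [reducedField, h3, smul_zero]

end Integrals

/-! ### The vector field is not identically zero. -/

section Nondegenerate

/-- The derivative of the numerator of `J₂` along a field tangent to the levels of `J₁`, multiplied
by `D` and corrected by the derivative of `D`. -/
def transversality (e : ℕ → ℝ) (a u v : ℝ) : ℝ :=
  2 * (u * quarticHess e 0 u v u v + (v + a * u) * quarticHess e 1 u v u v +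
      a * v * quarticHess e 2 u v u v) * polarDet e 1 a u v -
    (u * polarNumY e 1 a u v - v * polarNumX e 1 a u v) *
      (quarticHess e 0 u v u v * quarticHess e 2 1 a u v +
        quarticHess e 0 1 a u v * quarticHess e 2 u v u v -
        2 * quarticHess e 1 1 a u v * quarticHess e 1 u v u v)

variable {e : ℕ → ℝ}

/-- The vector (y₂ - y₀y₁, y₁², y₁y₂) is the image on the quotient of the shear x₀ ↦ x₀ + εx₁, which
preserves ω(x₀, x₁). Along it each Hessian entry at (x₀, x₁) has as derivative the corresponding
entry at (x₁, x₁). -/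
theorem partials_reducedNextArea_dotProduct {y : Fin 3 → ℝ}
    (hD : polarDet e 1 (y 0) (y 1) (y 2) ≠ 0) :
    polarDet e 1 (y 0) (y 1) (y 2) ^ 2 * (partials (reducedNextArea e) y ⬝ᵥ
      ![y 2 - y 0 * y 1, y 1 ^ 2, y 1 * y 2]) = transversality e (y 0) (y 1) (y 2) := by
  have hb : ∀ k, ∃ b', HasPartialsAt (fun y : Fin 3 → ℝ => quarticHess e k 1 (y 0) (y 1) (y 2)) b' y ∧
      b' 0 * (y 2 - y 0 * y 1) + b' 1 * y 1 ^ 2 + b' 2 * (y 1 * y 2) =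
        quarticHess e k (y 1) (y 2) (y 1) (y 2) := fun k => by
    refine ⟨_, (HasPartialsAt.const (x := y) 1).quarticHess (.coord 0) (.coord 1) (.coord 2) e k, ?_⟩
    simp [quarticHess]
    ring
  obtain ⟨b0, h0, r0⟩ := hb 0
  obtain ⟨b1, h1, r1⟩ := hb 1
  obtain ⟨b2, h2, r2⟩ := hb 2
  have hdet : HasPartialsAt (fun y : Fin 3 → ℝ => polarDet e 1 (y 0) (y 1) (y 2))
      (quarticHess e 0 1 (y 0) (y 1) (y 2) • b2 + quarticHess e 2 1 (y 0) (y 1) (y 2) • b0 -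
        (2 * quarticHess e 1 1 (y 0) (y 1) (y 2)) • b1) y := by
    simp only [polarDet, sq]
    refine (((HasPartialsAt.const 1).add (h0.mul h2)).sub (h1.mul h1)).congr_partials fun i => ?_
    simp
    ring
  have hX : HasPartialsAt (fun y : Fin 3 → ℝ => polarNumX e 1 (y 0) (y 1) (y 2)) _ y :=
    ((HasPartialsAt.const 1).sub (h1.mul (.const 1))).sub (h2.mul (.coord 0))
  have hY : HasPartialsAt (fun y : Fin 3 → ℝ => polarNumY e 1 (y 0) (y 1) (y 2)) _ y :=
    ((HasPartialsAt.coord 0).add (h0.mul (.const 1))).add (h1.mul (.coord 0))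
  have hN := ((((HasPartialsAt.coord (x := y) 1).mul hY).sub
    ((HasPartialsAt.coord 2).mul hX)).div hdet hD).partials_eq
  have hJ : reducedNextArea e = fun y => (y 1 * polarNumY e 1 (y 0) (y 1) (y 2) -
      y 2 * polarNumX e 1 (y 0) (y 1) (y 2)) / polarDet e 1 (y 0) (y 1) (y 2) := by
    funext z
    rw [reducedNextArea, polarX, polarY]
    ring
  rw [hJ, hN]
  simp only [dotProduct, Fin.sum_univ_three]
  simp
  -- Both sides are the polarized quartic at (x₀, x₁, x₁, x₁).
  have t : y 1 ^ 2 * quarticHess e 0 1 (y 0) (y 1) (y 2) +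
      2 * y 1 * y 2 * quarticHess e 1 1 (y 0) (y 1) (y 2) +
      y 2 ^ 2 * quarticHess e 2 1 (y 0) (y 1) (y 2) =
      y 1 * quarticHess e 0 (y 1) (y 2) (y 1) (y 2) +
        (y 2 + y 0 * y 1) * quarticHess e 1 (y 1) (y 2) (y 1) (y 2) +
        y 0 * y 2 * quarticHess e 2 (y 1) (y 2) (y 1) (y 2) := by
    unfold quarticHess
    ring
  rw [← r0, ← r1, ← r2] at t
  rw [transversality, ← r0, ← r1, ← r2]
  field_simp
  simp only [polarNumX, polarNumY]
  linear_combination polarDet e 1 (y 0) (y 1) (y 2) * t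

/-- The gradient of J₁ has last component 1. If the cross product vanished, the gradient of J₂ would
be a multiple of it and would annihilate the shear direction. -/
theorem reducedField_ne_zero {y : Fin 3 → ℝ} (hD : polarDet e 1 (y 0) (y 1) (y 2) ≠ 0)
    (h : transversality e (y 0) (y 1) (y 2) ≠ 0) : reducedField e y ≠ 0 := by
  intro h0
  rw [reducedField, smul_eq_zero_iff_right hD, (hasPartialsAt_reducedArea y).partials_eq] at h0
  refine h ?_
  rw [← partials_reducedNextArea_dotProduct hD]
  have h1 := congrFun h0 0
  have h2 := congrFun h0 1
  simp [cross] at h1 h2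
  simp [dotProduct, Fin.sum_univ_three, hD]
  linear_combination (y 2 - y 0 * y 1) * h2 - y 1 ^ 2 * h1

theorem isPolynomialFun_transversality :
    IsPolynomialFun fun y : Fin 3 → ℝ => transversality e (y 0) (y 1) (y 2) := by
  have ha := IsPolynomialFun.coord (0 : Fin 3)
  have hu := IsPolynomialFun.coord (1 : Fin 3)
  have hv := IsPolynomialFun.coord (2 : Fin 3)
  have hB := isPolynomialFun_quarticHess e hu hv hu hv
  have hb := isPolynomialFun_quarticHess e (.const 1) ha hu hv
  have hX := isPolynomialFun_polarNumX e (.const 1) ha hu hv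
  have hY := isPolynomialFun_polarNumY e (.const 1) ha hu hv
  have hD := isPolynomialFun_polarDet e (.const 1) ha hu hv
  exact (((IsPolynomialFun.const 2).mul (((hu.mul (hB 0)).add ((hv.add (ha.mul hu)).mul
    (hB 1))).add ((ha.mul hv).mul (hB 2)))).mul hD).sub (((hu.mul hY).sub (hv.mul hX)).mul
    ((((hB 0).mul (hb 2)).add ((hb 0).mul (hB 2))).sub (((IsPolynomialFun.const 2).mul
      (hb 1)).mul (hB 1))))

theorem exists_transversality_ne_zero (he : ∃ k ≤ 4, e k ≠ 0) :
    ∃ y : Fin 3 → ℝ, transversality e (y 0) (y 1) (y 2) ≠ 0 := by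
  by_contra! h
  have hT : ∀ a u v, transversality e a u v = 0 := fun a u v => h ![a, u, v]
  -- As a polynomial in (u, v), the transversality has terms of degrees 3, 4 and 5 only, and the
  -- cubic term is twice this expression. The values at the multiples 1, -1 and 2 of (u, v) isolate
  -- it.
  have hC : ∀ a u v, u * quarticHess e 0 u v u v + (v + a * u) * quarticHess e 1 u v u v +
      a * v * quarticHess e 2 u v u v = 0 := by
    intro a u v
    have h1 := hT a u v
    have h2 := hT a (-u) (-v)
    have h3 := hT a (2 * u) (2 * v)
    have h4 := hT a (-2 * u) (-2 * v)
    have s : ∀ t k, quarticHess e k (t * u) (t * v) (t * u) (t * v) =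
        t ^ 2 * quarticHess e k u v u v := fun t k => by unfold quarticHess; ring
    have s' : ∀ t k, quarticHess e k 1 a (t * u) (t * v) = t * quarticHess e k 1 a u v :=
      fun t k => by unfold quarticHess; ring
    rw [← neg_one_mul u, ← neg_one_mul v] at h2
    simp only [transversality, polarDet, polarNumX, polarNumY, s, s'] at h1 h2 h3
    linarith
  -- These values give e₀, e₃, e₀ ± 3e₁ + 3e₂ ± e₃ and e₃ + e₄, up to sign; their vanishing forces
  -- all five coefficients to be zero.
  have c0 := hC 0 1 0
  have c1 := hC 0 0 1
  have c2 := hC 0 1 1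
  have c3 := hC 0 1 (-1)
  have c4 := hC 1 0 1
  simp [quarticHess] at c0 c1 c2 c3 c4
  obtain ⟨k, hk, hk'⟩ := he
  refine hk' ?_
  interval_cases k <;> linarith

theorem generically_reducedField_ne_zero (he : ∃ k ≤ 4, e k ≠ 0) :
    Generically fun y => reducedField e y ≠ 0 := by
  obtain ⟨y₀, hy₀⟩ := exists_transversality_ne_zero he
  have h1 : Generically fun y : Fin 3 → ℝ => transversality e (y 0) (y 1) (y 2) ≠ 0 :=
    ⟨_, isPolynomialFun_transversality, Function.ne_iff.2 ⟨y₀, hy₀⟩, fun _ => id⟩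
  exact ((generically_reducedRegular e).and h1).mono fun y hy => reducedField_ne_zero hy.1.2.1 hy.2

end Nondegenerate

/-! ### The polar map of a binary quartic Hamiltonian -/

section Polarization

open MvPolynomial

theorem pderiv_pderiv_comm {σ : Type*} (i j : σ) (p : MvPolynomial σ ℝ) :
    pderiv i (pderiv j p) = pderiv j (pderiv i p) := by
  ext m
  classical
  simp only [coeff_pderiv, Finsupp.add_apply, Finsupp.single_apply, add_right_comm m]
  rcases eq_or_ne i j with rfl | h
  · rfl
  · simp [h, h.symm]
    ring

/-- A homogeneous polynomial of positive degree with vanishing partial derivatives is zero. -/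
theorem MvPolynomial.IsHomogeneous.eq_zero_of_pderiv {σ : Type*} [Fintype σ] {n : ℕ} (hn : n ≠ 0)
    {p : MvPolynomial σ ℝ} (hp : p.IsHomogeneous n) (h : ∀ i, pderiv i p = 0) : p = 0 := by
  have h1 := hp.sum_X_mul_pderiv
  simp only [h, mul_zero, Finset.sum_const_zero] at h1
  exact ((smul_eq_zero_iff_right hn).1 h1.symm)

/-- The fourth partial derivatives at the origin. -/
noncomputable def fourthPartial (H : MvPolynomial (Fin 2) ℝ) (i j k l : Fin 2) : ℝ :=
  eval 0 (pderiv i (pderiv j (pderiv k (pderiv l H))))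

/-- The fourth partial derivative at the origin, `k` times with respect to the second variable. -/
noncomputable def quarticCoeff (H : MvPolynomial (Fin 2) ℝ) (k : ℕ) : ℝ :=
  fourthPartial H (if 4 ≤ k then 1 else 0) (if 3 ≤ k then 1 else 0) (if 2 ≤ k then 1 else 0)
    (if 1 ≤ k then 1 else 0)

theorem fourthPartial_eq (H : MvPolynomial (Fin 2) ℝ) (i j k l : Fin 2) :
    fourthPartial H i j k l = quarticCoeff H (i + j + k + l : ℕ) := by
  unfold quarticCoeff fourthPartial
  have c := fun (p : MvPolynomial (Fin 2) ℝ) => pderiv_pderiv_comm (0 : Fin 2) 1 p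
  fin_cases i <;> fin_cases j <;> fin_cases k <;> fin_cases l <;> simp [c]

/-- By Euler's identity a homogeneous polynomial of positive degree is determined by its first
partials. Four applications reduce H to its fourth partials, which are constants and hence equal to
their values at the origin. -/
theorem exists_quarticCoeff_ne_zero {H : MvPolynomial (Fin 2) ℝ} (hH : H.IsHomogeneous 4)
    (hH0 : H ≠ 0) : ∃ k ≤ 4, quarticCoeff H k ≠ 0 := by
  by_contra! h
  refine hH0 (hH.eq_zero_of_pderiv (by norm_num) fun l => ?_)
  refine (hH.pderiv (i := l)).eq_zero_of_pderiv (by norm_num) fun k => ?_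
  refine (hH.pderiv.pderiv (i := k)).eq_zero_of_pderiv (by norm_num) fun j => ?_
  refine (hH.pderiv.pderiv.pderiv (i := j)).eq_zero_of_pderiv (by norm_num) fun i => ?_
  have h1 : (pderiv i (pderiv j (pderiv k (pderiv l H)))).IsHomogeneous 0 :=
    hH.pderiv.pderiv.pderiv.pderiv
  rw [← totalDegree_zero_iff_isHomogeneous, totalDegree_eq_zero_iff_eq_C] at h1
  rw [h1]
  have h2 := fourthPartial_eq H i j k l
  rw [h _ (by omega), fourthPartial, h1, eval_C] at h2
  rw [h2, C_0]

theorem polarization_pderiv (H : MvPolynomial (Fin 2) ℝ) (l : Fin 2) (x : Fin 3 → Fin 2 → ℝ) :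
    polarization (pderiv l H) x =
      1 / 6 * ∑ i, ∑ j, ∑ k, x 0 i * x 1 j * x 2 k * fourthPartial H i j k l := by
  simp [polarization, dirDeriv, fourthPartial, Fin.sum_univ_two, List.ofFn_succ]
  rw [show Nat.factorial 3 = 6 from rfl]
  push_cast
  ring

theorem polarization_add_C_mul {d : ℕ} (p q : MvPolynomial (Fin 2) ℝ) (a b : ℝ)
    (x : Fin d → Fin 2 → ℝ) :
    polarization (C a * p + C b * q) x = a * polarization p x + b * polarization q x := by
  have h : ∀ L : List (Fin 2 → ℝ), L.foldr dirDeriv (C a * p + C b * q) =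
      C a * L.foldr dirDeriv p + C b * L.foldr dirDeriv q := by
    intro L
    induction L with
    | nil => rfl
    | cons v L ih =>
      simp only [List.foldr_cons, ih, dirDeriv, Fin.sum_univ_two, map_add, pderiv_C_mul]
      ring
  simp only [polarization, h, map_add, map_mul, eval_C]
  ring

variable {Ω : Matrix (Fin 2) (Fin 2) ℝ} (H : MvPolynomial (Fin 2) ℝ) {h : ℝ}

theorem skew_fin_two (hΩ : Ω.transpose = -Ω) :
    Ω 0 0 = 0 ∧ Ω 1 1 = 0 ∧ Ω 1 0 = -Ω 0 1 := by
  have h0 := congrFun (congrFun hΩ 0) 0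
  have h1 := congrFun (congrFun hΩ 1) 1
  have h2 := congrFun (congrFun hΩ 0) 1
  simp only [Matrix.transpose_apply, Matrix.neg_apply] at h0 h1 h2
  exact ⟨by linarith, by linarith, h2⟩

theorem skew_ne_zero (hΩ : Ω.transpose = -Ω) (hΩ' : IsUnit Ω.det) : Ω 0 1 ≠ 0 := by
  obtain ⟨h0, h1, h2⟩ := skew_fin_two hΩ
  intro h
  simp [Matrix.det_fin_two, h0, h] at hΩ'

theorem symplecticForm_eq (hΩ : Ω.transpose = -Ω) (u v : Fin 2 → ℝ) :
    symplecticForm Ω u v = Ω 0 1 * (u 0 * v 1 - u 1 * v 0) := by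
  obtain ⟨h0, h1, h2⟩ := skew_fin_two hΩ
  simp [symplecticForm, dotProduct, Matrix.mulVec, Fin.sum_univ_two, h0, h1, h2]
  ring

/-- The coefficients of the polar map of the Hamiltonian `H` with time step `h`. -/
noncomputable def stepCoeff (Ω : Matrix (Fin 2) (Fin 2) ℝ) (H : MvPolynomial (Fin 2) ℝ) (h : ℝ)
    (k : ℕ) : ℝ :=
  h / (3 * Ω 0 1) * quarticCoeff H k

theorem exists_stepCoeff_ne_zero (hΩ : Ω.transpose = -Ω) (hΩ' : IsUnit Ω.det)
    (hH : H.IsHomogeneous 4) (hH0 : H ≠ 0) (hh : h ≠ 0) : ∃ k ≤ 4, stepCoeff Ω H h k ≠ 0 := by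
  obtain ⟨k, hk, hk'⟩ := exists_quarticCoeff_ne_zero hH hH0
  exact ⟨k, hk, mul_ne_zero (div_ne_zero hh (mul_ne_zero three_ne_zero (skew_ne_zero hΩ hΩ'))) hk'⟩

/-- The factor h / (3 Ω₀₁) in `stepCoeff` is 2h · (1/6) · Ω₀₁⁻¹, from the time step, the
polarization and the inverse of Ω. The off-diagonal signs of Ω⁻¹ produce the opposite signs of the
two components. -/
theorem polarField_hamiltonianField (hΩ : Ω.transpose = -Ω) (hΩ' : IsUnit Ω.det) (hh : h ≠ 0)
    (x : Fin 2 → Fin 2 → ℝ) (v : Fin 2 → ℝ) {b : ℕ → ℝ}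
    (hb : ∀ k, b k = quarticHess (stepCoeff Ω H h) k (x 0 0) (x 0 1) (x 1 0) (x 1 1)) :
    2 * h * polarField (hamiltonianField Ω H) (Fin.snoc x v : Fin 3 → Fin 2 → ℝ) 0 =
        -(b 1 * v 0 + b 2 * v 1) ∧
      2 * h * polarField (hamiltonianField Ω H) (Fin.snoc x v : Fin 3 → Fin 2 → ℝ) 1 =
        b 0 * v 0 + b 1 * v 1 := by
  have hw := skew_ne_zero hΩ hΩ'
  obtain ⟨h0, h1, h2⟩ := skew_fin_two hΩ
  have hdet : Ω.det = Ω 0 1 ^ 2 := by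
    rw [Matrix.det_fin_two, h0, h2]
    ring
  have hK : ∀ i j, Ω⁻¹ i j = (Ω 0 1 ^ 2)⁻¹ * Ω.adjugate i j := fun i j => by
    rw [Matrix.inv_def, hdet, Ring.inverse_eq_inv', Matrix.smul_apply, smul_eq_mul]
  have s0 : (Fin.snoc x v : Fin 3 → Fin 2 → ℝ) 0 = x 0 := rfl
  have s1 : (Fin.snoc x v : Fin 3 → Fin 2 → ℝ) 1 = x 1 := rfl
  have s2 : (Fin.snoc x v : Fin 3 → Fin 2 → ℝ) 2 = v := rfl
  simp only [polarField, hamiltonianField, Fin.sum_univ_two, polarization_add_C_mul,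
    polarization_pderiv, fourthPartial_eq, s0, s1, s2, hb, quarticHess, stepCoeff, hK,
    Matrix.adjugate_fin_two]
  constructor
  · simp [h0, h1, h2]
    field_simp
    ring
  · simp [h0, h1, h2]
    field_simp
    ring

end Polarization

/-! ### Identification of the polar map with its coordinate form. -/

section PolarMap

variable {Ω : Matrix (Fin 2) (Fin 2) ℝ} (H : MvPolynomial (Fin 2) ℝ) {h : ℝ}

theorem polarSystem_hamiltonianField (hΩ : Ω.transpose = -Ω) (hΩ' : IsUnit Ω.det) (hh : h ≠ 0)
    (x : Fin 2 → Fin 2 → ℝ) {b : ℕ → ℝ}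
    (hb : ∀ k, b k = quarticHess (stepCoeff Ω H h) k (x 0 0) (x 0 1) (x 1 0) (x 1 1)) :
    polarSystem (m := 1) (hamiltonianField Ω H) h x = !![1 + b 1, b 2; -b 0, 1 - b 1] := by
  have h1 := fun v => polarField_hamiltonianField H hΩ hΩ' hh x v hb
  have hc : ((1 : ℕ) : ℝ) + 1 = 2 := by norm_num
  ext i j
  simp only [polarSystem, polarMatrix, hc, Matrix.sub_apply, Matrix.smul_apply, smul_eq_mul,
    Matrix.of_apply]
  have h2 := h1 (Pi.single j 1)
  fin_cases i <;> fin_cases j <;> simp at h2 ⊢ <;> linarith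

theorem det_polarSystem (hΩ : Ω.transpose = -Ω) (hΩ' : IsUnit Ω.det) (hh : h ≠ 0)
    (x : Fin 2 → Fin 2 → ℝ) :
    (polarSystem (m := 1) (hamiltonianField Ω H) h x).det =
      polarDet (stepCoeff Ω H h) (x 0 0) (x 0 1) (x 1 0) (x 1 1) := by
  rw [polarSystem_hamiltonianField H hΩ hΩ' hh x fun _ => rfl, Matrix.det_fin_two_of, polarDet]
  ring

theorem polarMap_eq_polarStep (hΩ : Ω.transpose = -Ω) (hΩ' : IsUnit Ω.det) (hh : h ≠ 0) :
    polarMap (m := 1) (hamiltonianField Ω H) h = polarStep (stepCoeff Ω H h) := by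
  funext x
  have h1 : polarMap (m := 1) (hamiltonianField Ω H) h x 0 = x 1 := rfl
  have h2 : polarMap (m := 1) (hamiltonianField Ω H) h x 1 =
      (polarSystem (m := 1) (hamiltonianField Ω H) h x)⁻¹.mulVec (x 0) := rfl
  ext i j
  fin_cases i
  · simp [h1, polarStep]
  · simp only [Fin.mk_one, h2]
    -- The equality also holds on the singular set: there the matrix inverse and the quotients
    -- defining x₂ are both 0 by convention.
    rw [Matrix.inv_def, det_polarSystem H hΩ hΩ' hh,
      polarSystem_hamiltonianField H hΩ hΩ' hh x fun _ => rfl, Ring.inverse_eq_inv',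
      Matrix.adjugate_fin_two_of]
    fin_cases j <;>
      simp [polarStep, polarX, polarY, polarNumX, polarNumY, Matrix.mulVec,
        dotProduct, Fin.sum_univ_two] <;> ring

theorem isPolarStep_iff (hΩ : Ω.transpose = -Ω) (hΩ' : IsUnit Ω.det) (hh : h ≠ 0)
    {x y : Fin 2 → Fin 2 → ℝ}
    (hD : polarDet (stepCoeff Ω H h) (x 0 0) (x 0 1) (x 1 0) (x 1 1) ≠ 0) :
    IsPolarStep (m := 1) (hamiltonianField Ω H) h x y ↔ y = polarStep (stepCoeff Ω H h) x := by
  obtain ⟨f0, f1⟩ := polarField_hamiltonianField H hΩ hΩ' hh x (y 1) fun _ => rfl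
  have h1 : IsPolarStep (m := 1) (hamiltonianField Ω H) h x y ↔ y 0 = x 1 ∧
      (y 1 0 - x 0 0 = 2 * h * polarField (hamiltonianField Ω H)
        (Fin.snoc x (y 1) : Fin 3 → Fin 2 → ℝ) 0 ∧
      y 1 1 - x 0 1 = 2 * h * polarField (hamiltonianField Ω H)
        (Fin.snoc x (y 1) : Fin 3 → Fin 2 → ℝ) 1) := by
    have hc : ((1 : ℕ) : ℝ) + 1 = 2 := by norm_num
    unfold IsPolarStep
    rw [hc, Fin.forall_fin_one]
    refine and_congr Iff.rfl ?_
    rw [funext_iff, Fin.forall_fin_two]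
    have h2 : (2 : ℝ) * h ≠ 0 := mul_ne_zero two_ne_zero hh
    refine and_congr ?_ ?_ <;>
    · rw [Pi.smul_apply, smul_eq_mul, one_div, inv_mul_eq_iff_eq_mul₀ h2]
      rfl
  rw [h1, f0, f1]
  obtain ⟨r0, r1⟩ := polar_system hD
  constructor
  · rintro ⟨e0, e1, e2⟩
    ext i j
    fin_cases i
    · simp [polarStep, e0]
    · fin_cases j
      · simp only [Fin.mk_one, Fin.zero_eta, polarStep, Matrix.cons_val, polarX, polarNumX]
        rw [eq_div_iff hD]
        unfold polarDet
        linear_combination (1 - quarticHess (stepCoeff Ω H h) 1 (x 0 0) (x 0 1) (x 1 0) (x 1 1)) *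
          e1 - quarticHess (stepCoeff Ω H h) 2 (x 0 0) (x 0 1) (x 1 0) (x 1 1) * e2
      · simp only [Fin.mk_one, polarStep, Matrix.cons_val, polarY, polarNumY]
        rw [eq_div_iff hD]
        unfold polarDet
        linear_combination (1 + quarticHess (stepCoeff Ω H h) 1 (x 0 0) (x 0 1) (x 1 0) (x 1 1)) *
          e2 + quarticHess (stepCoeff Ω H h) 0 (x 0 0) (x 0 1) (x 1 0) (x 1 1) * e1
  · rintro rfl
    refine ⟨by simp [polarStep], ?_, ?_⟩
    · simp only [polarStep, Matrix.cons_val]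
      linarith
    · simp only [polarStep, Matrix.cons_val]
      linarith

end PolarMap

/-! ### Complete integrability -/

section Iterates

/-- A property that holds almost everywhere holds along almost every orbit. -/
theorem ae_forall_iterate {α : Type*} [MeasurableSpace α] {μ : Measure α} {f : α → α}
    (hf : Measure.QuasiMeasurePreserving f μ μ) {P : α → Prop} (h : ∀ᵐ x ∂μ, P x) :
    ∀ᵐ x ∂μ, ∀ n : ℕ, P (f^[n] x) :=
  ae_all_iff.2 fun n => (hf.iterate n).ae h

/-- An almost everywhere left inverse of a measure-preserving map is measure-preserving. -/
theorem MeasureTheory.MeasurePreserving.of_ae_leftInverse {α : Type*} [MeasurableSpace α]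
    {μ : Measure α} {f g : α → α} (hf : MeasurePreserving f μ μ) (hg : Measurable g)
    (h : ∀ᵐ x ∂μ, g (f x) = x) : MeasurePreserving g μ μ := by
  refine ⟨hg, ?_⟩
  conv_lhs => rw [← hf.map_eq, Measure.map_map hg hf.measurable]
  exact (Measure.map_congr (f := g ∘ f) (g := id) h).trans Measure.map_id

theorem isBirational_comp_self {E : Type*} [NormedAddCommGroup E] [NormedSpace ℝ E]
    [FiniteDimensional ℝ E] [MeasureSpace E] [BorelSpace E] [(volume : Measure E).IsAddHaarMeasure]
    {f g : E → E} (hf : IsRationalMap f) (hg : IsRationalMap g)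
    (hfm : Measure.QuasiMeasurePreserving f) (hgm : Measure.QuasiMeasurePreserving g)
    (hgf : Generically fun x => g (f x) = x) (hfg : Generically fun x => f (g x) = x) :
    IsBirational (f ∘ f) := by
  refine ⟨hf.comp hf hfm, g ∘ g, hg.comp hg hgm, ?_, ?_⟩
  · refine ((hgf.comp hf hfm).and hgf).mono fun x hx => ?_
    simp only [Function.comp_apply, hx.1, hx.2]
  · refine ((hfg.comp hg hgm).and hfg).mono fun x hx => ?_
    simp only [Function.comp_apply, hx.1, hx.2]

end Iterates

/-! ### Integrability of the square of the reduced map. -/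

section ReducedIntegrable

variable (e : ℕ → ℝ)

theorem ae_quotientDensity_ne_zero : ∀ᵐ y, quotientDensity e y ≠ 0 :=
  (generically_quotientDensity_ne_zero e).ae

theorem quasiMeasurePreserving_reducedStep : Measure.QuasiMeasurePreserving (reducedStep e) :=
  quasiMeasurePreserving_of_densityMeasure (measurable_quotientDensity e)
    (ae_quotientDensity_ne_zero e) (measurePreserving_reducedStep e)

theorem measurable_reducedStepInv : Measurable (reducedStepInv e) := by
  have hX : Measurable fun y : Fin 3 → ℝ => polarX (-e) (y 1) (y 2) 1 (y 0) := by
    unfold polarX polarNumX polarDet quarticHess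
    fun_prop
  have hY : Measurable fun y : Fin 3 → ℝ => polarY (-e) (y 1) (y 2) 1 (y 0) := by
    unfold polarY polarNumY polarDet quarticHess
    fun_prop
  exact measurable_cons_cons_cons (hY.div hX) hX (hX.mul (measurable_pi_apply 0))

theorem generically_reducedStepInv_reducedStep :
    Generically fun y => reducedStepInv e (reducedStep e y) = y :=
  (generically_reducedRegular e).mono fun _ => reducedStepInv_reducedStep

theorem generically_reducedStep_reducedStepInv :
    Generically fun y => reducedStep e (reducedStepInv e y) = y := by
  have h1 := generically_polarDet_ne_zero (-e) (.coord 1) (.coord 2) (.const 1) (.coord 0)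
    (x₀ := (0 : Fin 3 → ℝ)) (by simp)
  have h2 : Generically fun y : Fin 3 → ℝ => polarNumX (-e) (y 1) (y 2) 1 (y 0) ≠ 0 := by
    -- The numerator here is t + e₁t², which cannot vanish at both t = 1 and t = 2.
    obtain ⟨t, ht, ht'⟩ : ∃ t : ℝ, t ≠ 0 ∧ polarNumX (-e) t 0 1 0 ≠ 0 := by
      by_cases h : polarNumX (-e) 1 0 1 0 ≠ 0
      · exact ⟨1, one_ne_zero, h⟩
      · refine ⟨2, two_ne_zero, ?_⟩
        simp only [polarNumX, quarticHess] at h ⊢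
        norm_num at h ⊢
        intro h'
        linarith
    exact Generically.polynomial_ne_zero
      (isPolynomialFun_polarNumX (-e) (.coord 1) (.coord 2) (.const 1) (.coord 0))
      (x := ![0, t, 0]) (by simpa using ht')
  exact (h1.and h2).mono fun y hy =>
    reducedStep_reducedStepInv (div_ne_zero hy.2 hy.1.1) hy.1.1 hy.1.2

/-- An almost everywhere left inverse of a measure-preserving map preserves the same measure; the
inverse can therefore be composed with itself as a rational map. -/
theorem quasiMeasurePreserving_reducedStepInv :
    Measure.QuasiMeasurePreserving (reducedStepInv e) :=
  quasiMeasurePreserving_of_densityMeasure (measurable_quotientDensity e)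
    (ae_quotientDensity_ne_zero e) ((measurePreserving_reducedStep e).of_ae_leftInverse
      (measurable_reducedStepInv e) ((ae_densityMeasure_iff (measurable_quotientDensity e)
        (ae_quotientDensity_ne_zero e)).2 (generically_reducedStepInv_reducedStep e).ae))

/-- The integrals on the quotient. -/
noncomputable def reducedIntegral (w : ℝ) : Fin 2 → (Fin 3 → ℝ) → ℝ :=
  ![fun y => w * reducedArea y, fun y => w * reducedNextArea e y]

theorem linearIndependent_fderiv_const_mul {E : Type*} [NormedAddCommGroup E] [NormedSpace ℝ E]
    {w : ℝ} (hw : w ≠ 0) {f g : E → ℝ} {x : E} (hf : DifferentiableAt ℝ f x)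
    (hg : DifferentiableAt ℝ g x) (h : LinearIndependent ℝ ![fderiv ℝ f x, fderiv ℝ g x]) :
    LinearIndependent ℝ fun i : Fin 2 =>
      fderiv ℝ ((![fun y => w * f y, fun y => w * g y] : Fin 2 → E → ℝ) i) x := by
  have h1 := h.units_smul fun _ => Units.mk0 w hw
  convert h1 using 1
  ext i : 1
  fin_cases i
  · exact fderiv_const_mul hf w
  · exact fderiv_const_mul hg w

variable {e}

theorem isIntegrableMap_reducedStep (he : ∃ k ≤ 4, e k ≠ 0) {w : ℝ} (hw : w ≠ 0) :
    IsIntegrableMap (reducedStep e ∘ reducedStep e) (quotientDensity e) (reducedIntegral e w) := by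
  have hreg := generically_reducedRegular e
  have hreg' := hreg.comp (isRationalMap_reducedStep e) (quasiMeasurePreserving_reducedStep e)
  have hreg'' := hreg'.comp (isRationalMap_reducedStep e) (quasiMeasurePreserving_reducedStep e)
  refine ⟨by simp, ?_, isRationalFun_quotientDensity e, generically_quotientDensity_ne_zero e,
    (measurePreserving_reducedStep e).comp (measurePreserving_reducedStep e), ?_, ?_, ?_, ?_⟩
  · exact isBirational_comp_self (isRationalMap_reducedStep e) (isRationalMap_reducedStepInv e)
      (quasiMeasurePreserving_reducedStep e) (quasiMeasurePreserving_reducedStepInv e)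
      (generically_reducedStepInv_reducedStep e) (generically_reducedStep_reducedStepInv e)
  · intro i
    fin_cases i
    · exact (IsRationalFun.const w).mul isRationalFun_reducedArea
    · exact (IsRationalFun.const w).mul (isRationalFun_reducedNextArea e)
  · intro i
    refine (hreg.and hreg').mono fun y hy => ?_
    fin_cases i
    · simp [reducedIntegral, reducedArea_reducedStep hy.2.1, reducedNextArea_reducedStep hy.1]
    · simp [reducedIntegral, reducedArea_reducedStep hy.1.1, reducedNextArea_reducedStep hy.2]
  · refine (hreg.and (generically_reducedField_ne_zero he)).mono fun y hy => ?_
    exact linearIndependent_fderiv_const_mul hw (hasPartialsAt_reducedArea y).differentiableAt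
      (differentiableAt_reducedNextArea e hy.1.2.1) (linearIndependent_fderiv_of_reducedField hy.2)
  · refine ⟨reducedField e, isRationalMap_reducedField e, ?_⟩
    refine (((hreg.and hreg').and hreg'').and (generically_reducedField_ne_zero he)).mono
      fun y hy => ?_
    obtain ⟨⟨⟨h1, h2⟩, h3⟩, h4⟩ := hy
    obtain ⟨A, hA, -⟩ := exists_hasFDerivAt_reducedStep h1
    obtain ⟨B, hB, -⟩ := exists_hasFDerivAt_reducedStep h2
    -- The field is carried along from y to Φ(y) and then to Φ²(y), so regularity is needed at all
    -- three points.
    have ha := fderiv_reducedStep_reducedField h1 h2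
    have hb := fderiv_reducedStep_reducedField h2 h3
    obtain ⟨t1, t2⟩ := fderiv_reducedField h1.2.1
    refine ⟨h4, fun i => ?_, (hB.comp y hA).differentiableAt, ?_⟩
    · fin_cases i
      · change fderiv ℝ (fun y => w * reducedArea y) y _ = 0
        rw [fderiv_const_mul (hasPartialsAt_reducedArea y).differentiableAt]
        simp [t1]
      · change fderiv ℝ (fun y => w * reducedNextArea e y) y _ = 0
        rw [fderiv_const_mul (differentiableAt_reducedNextArea e h1.2.1)]
        simp [t2]
    · rw [(hB.comp y hA).fderiv, ← hA.fderiv, ← hB.fderiv, ContinuousLinearMap.comp_apply, ha, hb]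
      rfl

end ReducedIntegrable

/-! ### Symmetry, integrals and reconstruction for the polar map. -/

section Integrable

variable {e : ℕ → ℝ}

theorem quasiMeasurePreserving_polarStep : Measure.QuasiMeasurePreserving (polarStep e) :=
  quasiMeasurePreserving_of_densityMeasure (measurable_polarDensity e) (ae_polarDensity_ne_zero e)
    (measurePreserving_polarStep e)

/-- The new pair is (x₁, x₂), where x₁ scales by c⁻¹ and x₂ by c. The inversion of c is why only the
second iterate commutes with the group. -/
theorem polarStep_scaling (c : ℝˣ) (x : Fin 2 → Fin 2 → ℝ) :
    polarStep e (scaling c x) = scaling c⁻¹ (polarStep e x) := by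
  have h := mul_inv_cancel₀ c.ne_zero
  ext i j
  fin_cases i <;> fin_cases j <;>
    simp [polarStep, scaling_apply, polarX_smul e _ _ _ _ h, polarY_smul e _ _ _ _ h]

theorem isMeasurePreservingSymmetry_scaling :
    IsMeasurePreservingSymmetry (polarStep e)^[2] scaling (polarDensity e) where
  action_one x := by
    ext i j
    fin_cases i <;> simp [scaling]
  action_mul a b x := by
    ext i j
    fin_cases i <;> simp [scaling] <;> ring
  rational c := isRationalMap_vec₂
    (.pi fun i => .of_real (.of_polynomial ((IsPolynomialFun.const _).mul (.coord₂ 0 i))))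
    (.pi fun i => .of_real (.of_polynomial ((IsPolynomialFun.const _).mul (.coord₂ 1 i))))
  measurePreserving := measurePreserving_scaling e
  equivariant c x := by
    simp [polarStep_scaling]

theorem scalingQuotient_scaling (c : ℝˣ) (x : Fin 2 → Fin 2 → ℝ) :
    scalingQuotient (scaling c x) = scalingQuotient x := by
  have h := c.ne_zero
  ext i
  fin_cases i
  · simp [scalingQuotient, scaling_apply, mul_div_mul_left _ _ h]
  · simp [scalingQuotient, scaling_apply]
    field_simp
  · simp [scalingQuotient, scaling_apply]
    field_simp

theorem scalingSection_scalingQuotient {x : Fin 2 → Fin 2 → ℝ} (hx : x 0 0 ≠ 0) :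
    scalingSection (scalingQuotient x, x 0 0) = x := by
  ext i j
  fin_cases i <;> fin_cases j <;> simp [scalingSection, scalingQuotient] <;> field_simp

theorem scalingQuotient_scalingSection (y : Fin 3 → ℝ) {t : ℝ} (ht : t ≠ 0) :
    scalingQuotient (scalingSection (y, t)) = y ∧ scalingSection (y, t) 0 0 = t := by
  refine ⟨?_, rfl⟩
  ext i
  fin_cases i <;> simp [scalingSection, scalingQuotient] <;> field_simp

theorem isQuotientBy_scaling :
    IsQuotientBy scaling (polarDensity e) scalingQuotient (fun x => x 0 0) scalingSection
      (quotientDensity e) where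
  finrank_eq := by simp [Module.finrank_pi_fintype]
  proj_rational := isRationalMap_scalingQuotient
  fibre_rational := .of_polynomial (.coord₂ 0 0)
  inverse_rational := isRationalMap_scalingSection
  fibre_ne_zero := generically_coord₂_ne_zero 0 0
  left_inv _ := scalingSection_scalingQuotient
  right_inv y _ := scalingQuotient_scalingSection y
  proj_invariant := scalingQuotient_scaling
  fibre_equivariant c x := by simp [scaling_apply]
  orbits x x' hx hx' := by
    constructor
    · intro h
      obtain ⟨c, hc⟩ : ∃ c : ℝˣ, (c : ℝ) * x 0 0 = x' 0 0 :=
        ⟨Units.mk0 (x' 0 0 / x 0 0) (div_ne_zero hx' hx), div_mul_cancel₀ _ hx⟩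
      have h0 : scaling c x 0 0 = x' 0 0 := by rw [← hc]; simp [scaling_apply]
      refine ⟨c, (scalingSection_scalingQuotient (h0.trans_ne hx')).symm.trans ?_⟩
      rw [scalingQuotient_scaling, h, h0, scalingSection_scalingQuotient hx']
    · rintro ⟨c, rfl⟩
      exact (scalingQuotient_scaling c x).symm
  measure_eq := map_scalingQuotient e

variable (e) in
/-- The symplectic areas of consecutive pairs of points. -/
noncomputable def polarIntegral (w : ℝ) : Fin 2 → (Fin 2 → Fin 2 → ℝ) → ℝ :=
  ![fun x => w * (x 0 0 * x 1 1 - x 0 1 * x 1 0),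
    fun x => w * (x 1 0 * polarStep e x 1 1 - x 1 1 * polarStep e x 1 0)]

theorem reducedIntegral_scalingQuotient (w : ℝ) (i : Fin 2) {x : Fin 2 → Fin 2 → ℝ}
    (hx : x 0 0 ≠ 0) : reducedIntegral e w i (scalingQuotient x) = polarIntegral e w i x := by
  have h1 := polarX_smul e (x 0 0) (x 0 1) (x 1 0) (x 1 1) (inv_mul_cancel₀ hx)
  have h2 := polarY_smul e (x 0 0) (x 0 1) (x 1 0) (x 1 1) (inv_mul_cancel₀ hx)
  rw [inv_mul_cancel₀ hx, ← div_eq_inv_mul (x 0 1)] at h1 h2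
  fin_cases i
  · simp [reducedIntegral, polarIntegral, reducedArea, scalingQuotient]
    field_simp
    simp
  · simp [reducedIntegral, polarIntegral, reducedNextArea, scalingQuotient, h1, h2, polarStep]
    field_simp
    simp

theorem isRationalFun_polarIntegral (w : ℝ) (i : Fin 2) : IsRationalFun (polarIntegral e w i) := by
  fin_cases i
  · exact .of_polynomial ((IsPolynomialFun.const w).mul
      (((IsPolynomialFun.coord₂ 0 0).mul (.coord₂ 1 1)).sub
        ((IsPolynomialFun.coord₂ 0 1).mul (.coord₂ 1 0))))
  · exact (IsRationalFun.const w).mul (((IsRationalFun.of_polynomial (.coord₂ 1 0)).mul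
      (isRationalFun_polarY e (.coord₂ 0 0) (.coord₂ 0 1) (.coord₂ 1 0) (.coord₂ 1 1))).sub
      ((IsRationalFun.of_polynomial (.coord₂ 1 1)).mul
      (isRationalFun_polarX e (.coord₂ 0 0) (.coord₂ 0 1) (.coord₂ 1 0) (.coord₂ 1 1))))

theorem polarIntegral_scaling (w : ℝ) (i : Fin 2) (c : ℝˣ) (x : Fin 2 → Fin 2 → ℝ) :
    polarIntegral e w i (scaling c x) = polarIntegral e w i x := by
  have h := c.ne_zero
  fin_cases i
  · simp [polarIntegral, scaling_apply]
    field_simp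
    simp
  · change w * (scaling c x 1 0 * polarStep e (scaling c x) 1 1 -
      scaling c x 1 1 * polarStep e (scaling c x) 1 0) = _
    rw [polarStep_scaling]
    simp [scaling_apply, polarIntegral]
    field_simp
    simp

variable (e) in
theorem generically_polarDet_polarStep_ne_zero :
    Generically fun x : Fin 2 → Fin 2 → ℝ => polarDet e (x 0 0) (x 0 1) (x 1 0) (x 1 1) ≠ 0 ∧
      polarDet e (x 1 0) (x 1 1) (polarStep e x 1 0) (polarStep e x 1 1) ≠ 0 :=
  generically_polarDet_ne_zero e (.coord₂ 0 0) (.coord₂ 0 1) (.coord₂ 1 0) (.coord₂ 1 1)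
    (x₀ := (0 : Fin 2 → Fin 2 → ℝ)) (by simp)

theorem generically_polarIntegral_invariant (w : ℝ) (i : Fin 2) :
    Generically fun x => polarIntegral e w i ((polarStep e)^[2] x) = polarIntegral e w i x := by
  have h1 := generically_polarDet_polarStep_ne_zero e
  have h2 := h1.comp (isRationalMap_polarStep e) quasiMeasurePreserving_polarStep
  have key : ∀ x : Fin 2 → Fin 2 → ℝ, (polarDet e (x 0 0) (x 0 1) (x 1 0) (x 1 1) ≠ 0 ∧
      polarDet e (x 1 0) (x 1 1) (polarStep e x 1 0) (polarStep e x 1 1) ≠ 0) →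
      polarIntegral e w 1 (polarStep e x) = polarIntegral e w 0 x := fun x hx => by
    rw [polarIntegral]
    exact congrArg (w * ·) (polar_area hx.1 rfl rfl hx.2)
  have key' : ∀ x, polarIntegral e w 0 (polarStep e x) = polarIntegral e w 1 x := fun x => rfl
  refine (h1.and h2).mono fun x hx => ?_
  simp only [Function.iterate_succ, Function.iterate_zero, Function.comp_apply, id_eq]
  fin_cases i
  · exact (key' _).trans (key _ hx.1)
  · exact (key _ hx.2).trans (key' _)

theorem differentiableAt_polarIntegral (w : ℝ) (i : Fin 2) {x : Fin 2 → Fin 2 → ℝ}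
    (hx : polarDet e (x 0 0) (x 0 1) (x 1 0) (x 1 1) ≠ 0) :
    DifferentiableAt ℝ (polarIntegral e w i) x := by
  have hc : ∀ i j : Fin 2, Differentiable ℝ fun x : Fin 2 → Fin 2 → ℝ => x i j :=
    fun i j => (IsPolynomialFun.coord₂ i j).differentiable_and_fderiv.1
  have hD : IsPolynomialFun fun x : Fin 2 → Fin 2 → ℝ =>
      polarDet e (x 0 0) (x 0 1) (x 1 0) (x 1 1) :=
    isPolynomialFun_polarDet e (.coord₂ 0 0) (.coord₂ 0 1) (.coord₂ 1 0) (.coord₂ 1 1)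
  have hX : IsPolynomialFun fun x : Fin 2 → Fin 2 → ℝ =>
      polarNumX e (x 0 0) (x 0 1) (x 1 0) (x 1 1) :=
    isPolynomialFun_polarNumX e (.coord₂ 0 0) (.coord₂ 0 1) (.coord₂ 1 0) (.coord₂ 1 1)
  have hY : IsPolynomialFun fun x : Fin 2 → Fin 2 → ℝ =>
      polarNumY e (x 0 0) (x 0 1) (x 1 0) (x 1 1) :=
    isPolynomialFun_polarNumY e (.coord₂ 0 0) (.coord₂ 0 1) (.coord₂ 1 0) (.coord₂ 1 1)
  have key : ∀ p q : (Fin 2 → Fin 2 → ℝ) → ℝ, IsPolynomialFun p → IsPolynomialFun q → q x ≠ 0 →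
      DifferentiableAt ℝ (fun x => p x / q x) x := fun p q hp hq h => by
    simp only [div_eq_mul_inv]
    exact (hp.differentiable_and_fderiv.1 x).fun_mul
      ((hq.differentiable_and_fderiv.1 x).fun_inv h)
  have hX' := key _ _ hX hD hx
  have hY' := key _ _ hY hD hx
  fin_cases i
  · change DifferentiableAt ℝ (fun x : Fin 2 → Fin 2 → ℝ =>
      w * (x 0 0 * x 1 1 - x 0 1 * x 1 0)) x
    exact (((hc 0 0 x).fun_mul (hc 1 1 x)).fun_sub ((hc 0 1 x).fun_mul (hc 1 0 x))).const_mul w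
  · change DifferentiableAt ℝ (fun x : Fin 2 → Fin 2 → ℝ =>
      w * (x 1 0 * polarY e (x 0 0) (x 0 1) (x 1 0) (x 1 1) -
        x 1 1 * polarX e (x 0 0) (x 0 1) (x 1 0) (x 1 1))) x
    exact (((hc 1 0 x).fun_mul hY').fun_sub ((hc 1 1 x).fun_mul hX')).const_mul w

/-- On the slice x₀₀ = t the integrals become J₁, J₂ through y ↦ R(y, t). The differentials of the J
are thus those of the I composed with a fixed linear map, and independence after composition implies
independence before it. -/
theorem functionallyIndependent_polarIntegral (he : ∃ k ≤ 4, e k ≠ 0) {w : ℝ} (hw : w ≠ 0) :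
    FunctionallyIndependent (polarIntegral e w) := by
  have h1 := (isIntegrableMap_reducedStep he hw).integral_independent.comp
    isRationalMap_scalingQuotient quasiMeasurePreserving_scalingQuotient
  refine ((h1.and (generically_coord₂_ne_zero (0 : Fin 2) (0 : Fin 2))).and
    (generically_polarDet_polarStep_ne_zero e)).mono fun x hx => ?_
  obtain ⟨⟨hi, hs⟩, hD, -⟩ := hx
  have hR : Differentiable ℝ fun y : Fin 3 → ℝ => scalingSection (y, x 0 0) := by
    rw [differentiable_pi]
    intro i
    rw [differentiable_pi]
    intro j
    fin_cases i <;> fin_cases j <;> simp [scalingSection] <;> fun_prop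
  have hR' := (hR (scalingQuotient x)).hasFDerivAt
  set L := fderiv ℝ (fun y : Fin 3 → ℝ => scalingSection (y, x 0 0)) (scalingQuotient x)
  refine LinearIndependent.of_comp
    ((ContinuousLinearMap.compL ℝ (Fin 3 → ℝ) (Fin 2 → Fin 2 → ℝ) ℝ).flip L).toLinearMap ?_
  have h0 : (fun i => (fderiv ℝ (polarIntegral e w i) x).comp L) =
      fun i => fderiv ℝ (reducedIntegral e w i) (scalingQuotient x) := by
    funext i
    have h2 : reducedIntegral e w i =
        fun y => polarIntegral e w i (scalingSection (y, x 0 0)) := by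
      funext y
      obtain ⟨h3, h4⟩ := scalingQuotient_scalingSection y hs
      rw [← reducedIntegral_scalingQuotient w i (by rw [h4]; exact hs), h3]
    have h5 : DifferentiableAt ℝ (polarIntegral e w i)
        (scalingSection (scalingQuotient x, x 0 0)) := by
      rw [scalingSection_scalingQuotient hs]
      exact differentiableAt_polarIntegral w i hD
    have h6 := (h5.hasFDerivAt.comp (scalingQuotient x) hR').fderiv
    rw [scalingSection_scalingQuotient hs] at h6
    rw [h2]
    exact h6.symm
  change LinearIndependent ℝ fun i => (fderiv ℝ (polarIntegral e w i) x).comp L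
  rw [h0]
  exact hi

theorem polarStep_polarStep_apply {x : Fin 2 → Fin 2 → ℝ} (hx : x 0 0 ≠ 0) :
    polarStep e (polarStep e x) 0 0 = x 0 0 * polarX e 1 (scalingQuotient x 0)
      (scalingQuotient x 1) (scalingQuotient x 2) := by
  have h := polarX_smul e (x 0 0) (x 0 1) (x 1 0) (x 1 1) (inv_mul_cancel₀ hx)
  rw [inv_mul_cancel₀ hx, ← div_eq_inv_mul (x 0 1)] at h
  simp only [scalingQuotient, Matrix.cons_val]
  rw [h, mul_inv_cancel_left₀ hx]
  rfl

/-- The reconstruction of the orbits of the polar map from those of the reduced map. -/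
theorem reconstruction_polarStep {x : Fin 2 → Fin 2 → ℝ}
    (hx : ∀ n : ℕ, (polarStep e)^[n] x 0 0 ≠ 0) (n : ℕ) :
    scalingQuotient ((polarStep e)^[2 * n] x) =
        (reducedStep e ∘ reducedStep e)^[n] (scalingQuotient x) ∧
      (polarStep e)^[2 * n] x 0 0 = (∏ i ∈ Finset.range n, (fun y : Fin 3 → ℝ =>
        polarX e 1 (y 0) (y 1) (y 2)) ((reducedStep e ∘ reducedStep e)^[i] (scalingQuotient x))) *
        x 0 0 := by
  induction n with
  | zero => simp
  | succ n ih =>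
    obtain ⟨h1, h2⟩ := ih
    have hn := hx (2 * n)
    have hn' := hx (2 * n + 1)
    rw [Function.iterate_succ_apply'] at hn'
    rw [Finset.prod_range_succ, ← h1, Function.iterate_succ_apply', ← h1, mul_add_one,
      Function.iterate_succ_apply', Function.iterate_succ_apply']
    refine ⟨by rw [scalingQuotient_polarStep e hn', scalingQuotient_polarStep e hn]; rfl, ?_⟩
    rw [polarStep_polarStep_apply hn, mul_right_comm, ← h2, mul_comm]

theorem isCompletelyIntegrable_polarStep (he : ∃ k ≤ 4, e k ≠ 0) {w : ℝ} (hw : w ≠ 0) :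
    IsCompletelyIntegrable (polarStep e) 2 scaling (polarDensity e) (polarIntegral e w) := by
  have h0 : Generically fun x : Fin 2 → Fin 2 → ℝ => x 0 0 ≠ 0 :=
    generically_coord₂_ne_zero (0 : Fin 2) (0 : Fin 2)
  have h1 : Generically fun x : Fin 2 → Fin 2 → ℝ => x 1 0 ≠ 0 :=
    generically_coord₂_ne_zero (1 : Fin 2) (0 : Fin 2)
  refine ⟨two_pos, by simp [Module.finrank_pi_fintype], isBirational_polarStep e,
    isRationalFun_polarDensity e, ?_, measurePreserving_polarStep e,
    isMeasurePreservingSymmetry_scaling, isRationalFun_polarIntegral w,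
    generically_polarIntegral_invariant w, functionallyIndependent_polarIntegral he hw,
    polarIntegral_scaling w, scalingQuotient, fun x => x 0 0, scalingSection,
    reducedStep e ∘ reducedStep e, quotientDensity e, reducedIntegral e w,
    fun y => polarX e 1 (y 0) (y 1) (y 2), isQuotientBy_scaling, ?_, fun i => ?_,
    isIntegrableMap_reducedStep he hw,
    isRationalFun_polarX e (.const 1) (.coord 0) (.coord 1) (.coord 2), ?_, ?_, ?_⟩
  · exact (generically_polarDet_polarStep_ne_zero e).mono fun x hx => one_div_ne_zero hx.1
  · refine (h0.and h1).mono fun x hx => ?_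
    change scalingQuotient (polarStep e (polarStep e x)) = _
    rw [scalingQuotient_polarStep e hx.2, scalingQuotient_polarStep e hx.1]
    rfl
  · exact h0.mono fun x => reducedIntegral_scalingQuotient w i
  · have h2 := Generically.polynomial_ne_zero (isPolynomialFun_polarNumX e (.const 1) (.coord 0)
      (.coord 1) (.coord 2)) (x := (0 : Fin 3 → ℝ)) (by simp [polarNumX, quarticHess])
    have h3 := generically_polarDet_ne_zero e (.const 1) (.coord 0) (.coord 1) (.coord 2)
      (x₀ := (0 : Fin 3 → ℝ)) (by simp)
    exact (h2.and h3).mono fun y hy => div_ne_zero hy.1 hy.2.1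
  · exact h0.mono fun x hx => (polarStep_polarStep_apply hx).trans (mul_comm _ _)
  -- Almost every orbit avoids s = 0 at all times, odd ones included, since each Ψ-step factors
  -- through a single polar step. That g does not vanish along the orbit then follows from s(ψ(x)) =
  -- g(π(x)) s(x).
  · refine (ae_forall_iterate (quasiMeasurePreserving_polarStep (e := e)) h0.ae).mono fun x hx n => ?_
    obtain ⟨h2, h3⟩ := reconstruction_polarStep hx n
    have h4 : (polarStep e)^[2 * (n + 1)] x 0 0 = (polarStep e)^[2 * n] x 0 0 *
        (fun y : Fin 3 → ℝ => polarX e 1 (y 0) (y 1) (y 2))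
          ((reducedStep e ∘ reducedStep e)^[n] (scalingQuotient x)) := by
      rw [← h2, mul_add_one, Function.iterate_succ_apply', Function.iterate_succ_apply']
      exact polarStep_polarStep_apply (hx _)
    have h5 := mul_ne_zero_iff.1 (h4.symm.trans_ne (hx _))
    refine ⟨h5.1, h5.2, h2, ?_, fun j _ => ?_⟩
    · beta_reduce at h4 h5 ⊢
      rw [h4, abs_mul, Real.log_mul (abs_ne_zero.2 h5.1) (abs_ne_zero.2 h5.2)]
    · rw [← h3, ← h2, scalingSection_scalingQuotient h5.1, ← Function.iterate_add_apply, add_comm]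

end Integrable

theorem mainTheorem3 (Ω : Matrix (Fin 2) (Fin 2) ℝ) (hΩ : Ω.transpose = -Ω) (hΩ' : IsUnit Ω.det)
    (H : MvPolynomial (Fin 2) ℝ) (hH : H.IsHomogeneous 4) (hH0 : H ≠ 0) (h : ℝ) (hh : h ≠ 0)
    (f : Fin 2 → MvPolynomial (Fin 2) ℝ) (hf : f = hamiltonianField Ω H)
    (φ : (Fin 2 → Fin 2 → ℝ) → Fin 2 → Fin 2 → ℝ) (hφ : φ = polarMap (m := 1) f h) :
    (Generically fun x : Fin 2 → Fin 2 → ℝ => (polarSystem (m := 1) f h x).det ≠ 0) ∧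
    (∀ x y : Fin 2 → Fin 2 → ℝ, (polarSystem (m := 1) f h x).det ≠ 0 →
      (IsPolarStep (m := 1) f h x y ↔ y = φ x)) ∧
    (∀ᵐ x, ∀ n : ℕ, IsPolarStep (m := 1) f h (φ^[n] x) (φ^[n + 1] x)) ∧
    IsCompletelyIntegrable φ 2 scaling
      (fun x => 1 / (polarSystem (m := 1) f h x).det)
      ![fun x => symplecticForm Ω (x 0) (x 1), fun x => symplecticForm Ω (x 1) (φ x 1)] := by
  subst hf hφ
  rw [polarMap_eq_polarStep H hΩ hΩ' hh]
  simp only [det_polarSystem H hΩ hΩ' hh]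
  have hD := (generically_polarDet_polarStep_ne_zero (stepCoeff Ω H h)).mono fun _ hx => hx.1
  refine ⟨hD, fun x y hx => isPolarStep_iff H hΩ hΩ' hh hx, ?_, ?_⟩
  · refine (ae_forall_iterate (quasiMeasurePreserving_polarStep (e := stepCoeff Ω H h)) hD.ae).mono fun x hx n => ?_
    exact (isPolarStep_iff H hΩ hΩ' hh (hx n)).2 (Function.iterate_succ_apply' _ _ _)
  · have h1 : (fun x : Fin 2 → Fin 2 → ℝ => 1 / polarDet (stepCoeff Ω H h) (x 0 0) (x 0 1) (x 1 0)
        (x 1 1)) = polarDensity (stepCoeff Ω H h) := rfl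
    have h2 : ![fun x => symplecticForm Ω (x 0) (x 1),
        fun x => symplecticForm Ω (x 1) (polarStep (stepCoeff Ω H h) x 1)] =
        polarIntegral (stepCoeff Ω H h) (Ω 0 1) := by
      simp only [symplecticForm_eq hΩ]
      rfl
    rw [h1, h2]
    exact isCompletelyIntegrable_polarStep (exists_stepCoeff_ne_zero H hΩ hΩ' hH hH0 hh)
      (skew_ne_zero hΩ hΩ')
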